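/- **Theorem 1.1.** Let $-\infty<a<b<\infty$, $0<T<\infty$, and let $\mu$ be a finite positive Borel measure on $\mathbb R$ with $\operatorname{supp}\mu\subseteq[a,b]$, $\mu((a,b))>0$ and $\mu(\{a\})=\mu(\{b\})=0$ (for instance, $\mu$ without atoms). Let $H^1(a,b)$ be the real Sobolev space of functions in $L^2(a,b)$ with weak derivative in $L^2(a,b)$, let $H_0^1(a,b)$ be the closure of $C_c^\infty(a,b)$ in it, and put $\mathcal E(u,v)=\int_a^b u'v'\,dx$. Let $\iota:H_0^1(a,b)\to L^2_\mu[a,b]$ be the bounded linear map that extends the inclusion of $C_c^\infty(a,b)$, and let $$\operatorname{Dom}\mathcal E=\{u\in H_0^1(a,b):\ \mathcal E(u,v)=0\ \text{ for all } v\in H_0^1(a,b)\text{ with } \|\iota v\|_\mu=0\},$$ normed as a subspace of $H^1(a,b)$ (equivalently, by $\mathcal E(u,u)^{1/2}$). Embed $\operatorname{Dom}\mathcal E\hookrightarrow L^2_\mu[a,b]$ by $\iota$ and $L^2_\mu[a,b]\hookrightarrow(\operatorname{Dom}\mathcal E)'$ by $w\mapsto(w,\iota\,\cdot\,)_\mu$.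 Then for all $g\in\operatorname{Dom}\mathcal E$, $h\in L^2_\mu[a,b]$ and $f\in L^2(0,T;\operatorname{Dom}\mathcal E)$, the problem $$u_{tt}-\Delta_\mu u=f\ \text{ on }[a,b]\times[0,T],\qquad u=0\ \text{ on }\{a,b\}\times[0,T],\qquad u=g,\ u_t=h\ \text{ at } t=0,$$ has a unique weak solution. Here a weak solution is a $u\in L^2(0,T;\operatorname{Dom}\mathcal E)$ whose weak derivatives in time satisfy $u_t\in L^2(0,T;L^2_\mu[a,b])$ (derivative of $u$ as an $L^2_\mu[a,b]$-valued function) and $u_{tt}\in L^2(0,T;(\operatorname{Dom}\mathcal E)')$ (derivative of $u_t$ as a $(\operatorname{Dom}\mathcal E)'$-valued function), such that 1. for each $v\in\operatorname{Dom}\mathcal E$, $\langle u_{tt}(t),v\rangle+\mathcal E(u(t),v)=(f(t),v)_\mu$ for Lebesgue-a.e. $t\in[0,T]$; 2. $u(0)=g$ and $u_t(0)=h$, where $u$ and $u_t$ are taken as their continuous representatives $[0,T]\to L^2_\mu[a,b]$ and $[0,T]\to(\operatorname{Dom}\mathcal E)'$ respectively (part of the requirement is that these exist). A weak derivative of $w\in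 L^1(0,T;X)$ is a $w'\in L^1(0,T;X)$ with $\int_0^T\varphi'\,w\,dt=-\int_0^T\varphi\,w'\,dt$ for all $\varphi\in C_c^\infty(0,T)$. -/

import Mathlib

open MeasureTheory Set TopologicalSpace
open scoped ENNReal

noncomputable section

namespace FractalWave

/-! ### Test functions, Bochner spaces and weak derivatives on an open interval -/

/-- The space `C_c^∞(a,b)` of real-valued smooth functions with compact support in `(a,b)`. -/
abbrev Test (a b : ℝ) : Type := TestFunction (⟨Ioo a b, isOpen_Ioo⟩ : Opens ℝ) ℝ ⊤

/-- The Bochner space `L²(a,b;X)` (with respect to Lebesgue measure). -/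
abbrev L2 (a b : ℝ) (X : Type*) [NormedAddCommGroup X] : Type _ :=
  Lp X 2 (volume.restrict (Ioo a b))

/-- `w'` is the weak derivative of `w` on `(a,b)`: both are in `L¹(a,b;X)` and
`∫ φ' w = - ∫ φ w'` for all scalar test functions `φ ∈ C_c^∞(a,b)`. -/
structure HasWeakDeriv {X : Type*} [NormedAddCommGroup X] [NormedSpace ℝ X]
    (a b : ℝ) (w w' : ℝ → X) : Prop where
  integrable : Integrable w (volume.restrict (Ioo a b))
  integrable_deriv : Integrable w' (volume.restrict (Ioo a b))
  integral_eq : ∀ φ : Test a b,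
    ∫ t in Ioo a b, deriv φ t • w t = - ∫ t in Ioo a b, φ t • w' t

section Helpers

variable {a b : ℝ}

lemma Test.contDiff_deriv (φ : Test a b) : ContDiff ℝ (⊤ : ℕ∞) (deriv φ) := by
  have h : ContDiff ℝ (⊤ : ℕ∞) φ := φ.contDiff
  have h' : ContDiff ℝ ((⊤ : ℕ∞) + 1) φ := by simpa using h
  exact (contDiff_succ_iff_deriv.1 h').2.2

lemma Test.hasDerivAt (φ : Test a b) (x : ℝ) : HasDerivAt φ (deriv φ x) x := by
  have h : ContDiff ℝ (⊤ : ℕ∞) φ := φ.contDiff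
  exact ((h.differentiable (by simp)) x).hasDerivAt

lemma Test.hasCompactSupport_deriv (φ : Test a b) : HasCompactSupport (deriv φ) :=
  φ.hasCompactSupport.deriv

lemma Test.eq_zero (φ : Test a b) {x : ℝ} (hx : x ∉ Ioo a b) : φ x = 0 := by
  by_contra h
  exact hx (φ.tsupport_subset (subset_tsupport _ h))

lemma Test.memLp (φ : Test a b) (p : ℝ≥0∞) (ν : Measure ℝ) [IsFiniteMeasure ν] :
    MemLp φ p ν :=
  φ.continuous.memLp_of_hasCompactSupport φ.hasCompactSupport

lemma Test.memLp_deriv (φ : Test a b) (p : ℝ≥0∞) (ν : Measure ℝ) [IsFiniteMeasure ν] :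
    MemLp (deriv φ) p ν :=
  φ.contDiff_deriv.continuous.memLp_of_hasCompactSupport φ.hasCompactSupport_deriv

section Bochner

variable {X : Type*} [NormedAddCommGroup X] [NormedSpace ℝ X]

lemma Test.integrable_smul (φ : Test a b) {ν : Measure ℝ} [IsFiniteMeasure ν]
    {w : ℝ → X} (hw : Integrable w ν) : Integrable (fun t => φ t • w t) ν := by
  have := hw.smul_of_top_right (φ.memLp ∞ ν)
  exact this

lemma Test.integrable_deriv_smul (φ : Test a b) {ν : Measure ℝ} [IsFiniteMeasure ν]
    {w : ℝ → X} (hw : Integrable w ν) : Integrable (fun t => deriv φ t • w t) ν := by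
  have := hw.smul_of_top_right (φ.memLp_deriv ∞ ν)
  exact this

lemma HasWeakDeriv.add {u u' v v' : ℝ → X} (hu : HasWeakDeriv a b u u')
    (hv : HasWeakDeriv a b v v') : HasWeakDeriv a b (u + v) (u' + v') where
  integrable := hu.integrable.add hv.integrable
  integrable_deriv := hu.integrable_deriv.add hv.integrable_deriv
  integral_eq φ := by
    simp only [Pi.add_apply, smul_add]
    rw [integral_add (φ.integrable_deriv_smul hu.integrable)
        (φ.integrable_deriv_smul hv.integrable),
      integral_add (φ.integrable_smul hu.integrable_deriv)
        (φ.integrable_smul hv.integrable_deriv), hu.integral_eq, hv.integral_eq]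
    abel

lemma HasWeakDeriv.const_smul {u u' : ℝ → X} (c : ℝ) (hu : HasWeakDeriv a b u u') :
    HasWeakDeriv a b (c • u) (c • u') where
  integrable := hu.integrable.smul c
  integrable_deriv := hu.integrable_deriv.smul c
  integral_eq φ := by
    simp only [Pi.smul_apply, smul_comm _ c]
    rw [integral_smul, integral_smul, hu.integral_eq, smul_neg]

lemma HasWeakDeriv.congr {u u' v v' : ℝ → X} (hu : HasWeakDeriv a b u u')
    (h : u =ᵐ[volume.restrict (Ioo a b)] v) (h' : u' =ᵐ[volume.restrict (Ioo a b)] v') :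
    HasWeakDeriv a b v v' where
  integrable := hu.integrable.congr h
  integrable_deriv := hu.integrable_deriv.congr h'
  integral_eq φ := by
    rw [← integral_congr_ae (h.mono fun t ht => by simp only [ht] :
        (fun t => deriv φ t • u t) =ᵐ[volume.restrict (Ioo a b)] fun t => deriv φ t • v t),
      ← integral_congr_ae (h'.mono fun t ht => by simp only [ht] :
        (fun t => φ t • u' t) =ᵐ[volume.restrict (Ioo a b)] fun t => φ t • v' t)]
    exact hu.integral_eq φ

end Bochner

lemma Test.setIntegral_Ioo (φ : Test a b) (g : ℝ → ℝ) :
    ∫ t in Ioo a b, φ t * g t = ∫ t, φ t * g t := by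
  refine setIntegral_eq_integral_of_forall_compl_eq_zero fun x hx => ?_
  simp [φ.eq_zero hx]

/-- The classical derivative of a test function is its weak derivative. -/
lemma Test.hasWeakDeriv (ψ : Test a b) : HasWeakDeriv a b ψ (deriv ψ) where
  integrable := memLp_one_iff_integrable.1 (ψ.memLp 1 _)
  integrable_deriv := memLp_one_iff_integrable.1 (ψ.memLp_deriv 1 _)
  integral_eq φ := by
    simp only [smul_eq_mul]
    have h1 : ∫ t in Ioo a b, deriv φ t * ψ t = ∫ t, ψ t * deriv φ t := by
      rw [← ψ.setIntegral_Ioo]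
      simp only [mul_comm]
    rw [h1, φ.setIntegral_Ioo]
    have key := integral_mul_deriv_eq_deriv_mul_of_integrable (A := ℝ)
      (u := ψ) (v := φ) (u' := deriv ψ) (v' := deriv φ)
      (fun x _ => ψ.hasDerivAt x) (fun x _ => φ.hasDerivAt x)
      ((ψ.continuous.mul φ.contDiff_deriv.continuous).integrable_of_hasCompactSupport
        (ψ.hasCompactSupport.mul_right))
      ((ψ.contDiff_deriv.continuous.mul φ.continuous).integrable_of_hasCompactSupport
        (φ.hasCompactSupport.mul_left))
      ((ψ.continuous.mul φ.continuous).integrable_of_hasCompactSupport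
        (ψ.hasCompactSupport.mul_right))
    rw [key]
    simp only [mul_comm]

end Helpers

/-! ### The Sobolev spaces `H¹(a,b)` and `H₀¹(a,b)` -/

/-- The Sobolev space `H¹(a,b)`: the pairs `(u, u')` in `L²(a,b) × L²(a,b)` such that `u'` is the
weak derivative of `u`. Its inner product is `∫ u v + ∫ u' v'`. -/
def H1 (a b : ℝ) : Submodule ℝ (WithLp 2 (L2 a b ℝ × L2 a b ℝ)) where
  carrier := {p | HasWeakDeriv a b p.fst p.snd}
  zero_mem' := by
    have h : (fun _ => (0 : ℝ)) =ᵐ[volume.restrict (Ioo a b)] ((0 : L2 a b ℝ) : ℝ → ℝ) :=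
      (Lp.coeFn_zero ℝ 2 _).symm
    exact HasWeakDeriv.congr ⟨by simp, by simp, by simp⟩ h h
  add_mem' {p q} hp hq :=
    HasWeakDeriv.congr (HasWeakDeriv.add hp hq) (Lp.coeFn_add _ _).symm (Lp.coeFn_add _ _).symm
  smul_mem' c p hp :=
    HasWeakDeriv.congr (HasWeakDeriv.const_smul c hp) (Lp.coeFn_smul _ _).symm
      (Lp.coeFn_smul _ _).symm

/-- The inclusion of `C_c^∞(a,b)` into `H¹(a,b)`. -/
def testToH1 (a b : ℝ) : Test a b →ₗ[ℝ] H1 a b where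
  toFun φ := ⟨WithLp.toLp 2 ((φ.memLp 2 _).toLp φ, (φ.memLp_deriv 2 _).toLp (deriv φ)),
    HasWeakDeriv.congr φ.hasWeakDeriv (MemLp.coeFn_toLp (φ.memLp 2 _)).symm
      (MemLp.coeFn_toLp (φ.memLp_deriv 2 _)).symm⟩
  map_add' φ ψ := by
    have h : deriv (φ + ψ : Test a b) = deriv φ + deriv ψ := by
      funext x
      exact ((φ.hasDerivAt x).add (ψ.hasDerivAt x)).deriv
    apply Subtype.ext
    apply WithLp.ofLp_injective
    refine Prod.ext ?_ ?_
    · exact MemLp.toLp_add (φ.memLp 2 _) (ψ.memLp 2 _)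
    · exact (MemLp.toLp_congr ((φ + ψ : Test a b).memLp_deriv 2 _) ((φ.memLp_deriv 2 _).add (ψ.memLp_deriv 2 _)) (by rw [h])).trans
        (MemLp.toLp_add (φ.memLp_deriv 2 _) (ψ.memLp_deriv 2 _))
  map_smul' c φ := by
    have h : deriv (c • φ : Test a b) = c • deriv φ := by
      funext x
      exact ((φ.hasDerivAt x).const_smul c).deriv
    apply Subtype.ext
    apply WithLp.ofLp_injective
    refine Prod.ext ?_ ?_
    · exact MemLp.toLp_const_smul c (φ.memLp 2 _)
    · refine (MemLp.toLp_congr ((c • φ : Test a b).memLp_deriv 2 _) ((φ.memLp_deriv 2 _).const_smul c) (by rw [h])).trans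
        (MemLp.toLp_const_smul c (φ.memLp_deriv 2 (volume.restrict (Ioo a b))))

/-- `H₀¹(a,b)`: the closure of `C_c^∞(a,b)` in `H¹(a,b)`, with the norm of `H¹(a,b)`. -/
def H01 (a b : ℝ) : Type := (LinearMap.range (testToH1 a b)).topologicalClosure

instance (a b : ℝ) : NormedAddCommGroup (H01 a b) :=
  inferInstanceAs (NormedAddCommGroup (LinearMap.range (testToH1 a b)).topologicalClosure)

instance (a b : ℝ) : InnerProductSpace ℝ (H01 a b) :=
  inferInstanceAs (InnerProductSpace ℝ (LinearMap.range (testToH1 a b)).topologicalClosure)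

/-- The inclusion of `H₀¹(a,b)` into `H¹(a,b)`. -/
def H01.toH1 (a b : ℝ) : H01 a b →L[ℝ] H1 a b :=
  (LinearMap.range (testToH1 a b)).topologicalClosure.subtypeL

/-- The inclusion of `C_c^∞(a,b)` into `H₀¹(a,b)`. -/
def testToH01 (a b : ℝ) : Test a b →ₗ[ℝ] H01 a b :=
  (testToH1 a b).codRestrict (LinearMap.range (testToH1 a b)).topologicalClosure fun φ =>
    Submodule.le_topologicalClosure _ (LinearMap.mem_range_self _ φ)

/-- The weak derivative `u'` of `u ∈ H₀¹(a,b)`. -/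
def weakDeriv {a b : ℝ} (u : H01 a b) : L2 a b ℝ := (H01.toH1 a b u).1.snd

/-- The Dirichlet form `E(u,v) = ∫_a^b u' v' dx`. -/
def energy {a b : ℝ} (u v : H01 a b) : ℝ := ∫ x in Ioo a b, weakDeriv u x * weakDeriv v x

/-! ### The embedding into `L²_μ` and the domain of the form -/

/-- The space `L²_μ`. -/
abbrev L2mu (μ : Measure ℝ) : Type := Lp ℝ 2 μ

/-- The `μ`-equivalence class of a test function. -/
def testToL2mu (μ : Measure ℝ) [IsFiniteMeasure μ] (a b : ℝ) : Test a b →ₗ[ℝ] L2mu μ where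
  toFun φ := (φ.memLp 2 μ).toLp φ
  map_add' φ ψ := MemLp.toLp_add (φ.memLp 2 _) (ψ.memLp 2 _)
  map_smul' c φ := MemLp.toLp_const_smul c (φ.memLp 2 _)

/-- The bounded map `ι : H₀¹(a,b) → L²_μ` sending `u` to its `L²_μ`-representative: the continuous
extension of the map sending a test function, as an element of `H₀¹(a,b)`, to its class in
`L²_μ`. -/
def iota (μ : Measure ℝ) [IsFiniteMeasure μ] (a b : ℝ) : H01 a b →L[ℝ] L2mu μ :=
  (testToL2mu μ a b).extendOfNorm (testToH01 a b)

lemma denseRange_testToH01 (a b : ℝ) : DenseRange (testToH01 a b) := by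
  have key : DenseRange ((testToH1 a b).codRestrict
      (LinearMap.range (testToH1 a b)).topologicalClosure fun φ =>
        Submodule.le_topologicalClosure _ (LinearMap.mem_range_self _ φ)) := by
    intro u
    rw [closure_subtype, ← range_comp]
    exact u.2
  exact key

lemma Test.abs_le {a b : ℝ} (φ : Test a b) (x : ℝ) :
    |φ x| ≤ ∫ t in Ioo a b, |deriv φ t| := by
  by_cases hx : x ∈ Ioo a b
  · have hφa : φ a = 0 := φ.eq_zero (by simp)
    have hc := φ.contDiff_deriv.continuous
    have h : ∫ t in a..x, deriv φ t = φ x - φ a :=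
      intervalIntegral.integral_eq_sub_of_hasDerivAt (fun t _ => φ.hasDerivAt t)
        (hc.intervalIntegrable _ _)
    rw [hφa, sub_zero] at h
    rw [← h]
    refine (intervalIntegral.abs_integral_le_integral_abs hx.1.le).trans ?_
    rw [intervalIntegral.integral_of_le hx.1.le]
    refine setIntegral_mono_set ?_ (Filter.Eventually.of_forall fun t => abs_nonneg _) ?_
    · exact (memLp_one_iff_integrable.1 (φ.memLp_deriv 1 _)).abs
    · exact LE.le.eventuallyLE fun t ht => ⟨ht.1, ht.2.trans_lt hx.2⟩
  · rw [φ.eq_zero hx, abs_zero]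
    exact integral_nonneg fun t => abs_nonneg _

/-- The bound that makes `iota` well defined. -/
lemma exists_norm_testToL2mu_le (μ : Measure ℝ) [IsFiniteMeasure μ] (a b : ℝ) :
    ∃ C, ∀ φ : Test a b, ‖testToL2mu μ a b φ‖ ≤ C * ‖testToH01 a b φ‖ := by
  set ν := volume.restrict (Ioo a b) with hν
  set K : ℝ := ((ν univ) ^ (1 / (1 : ℝ≥0∞).toReal - 1 / (2 : ℝ≥0∞).toReal)).toReal with hK
  set M : ℝ := (measureUnivNNReal μ : ℝ) ^ (2 : ℝ≥0∞).toReal⁻¹ with hM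
  refine ⟨M * K, fun φ => ?_⟩
  have hd := φ.memLp_deriv 2 ν
  have h1 : ∫ t in Ioo a b, |deriv φ t| ≤ ‖hd.toLp (deriv φ)‖ * K := by
    have e1 : ∫ t in Ioo a b, |deriv φ t| = (eLpNorm (deriv φ) 1 ν).toReal := by
      rw [eLpNorm_one_eq_lintegral_enorm, ← integral_norm_eq_lintegral_enorm hd.1]
      rfl
    rw [e1, Lp.norm_toLp, hK, ← ENNReal.toReal_mul]
    refine ENNReal.toReal_mono (ENNReal.mul_ne_top hd.2.ne ?_)
      (eLpNorm_le_eLpNorm_mul_rpow_measure_univ (by norm_num) hd.1)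
    exact ENNReal.rpow_ne_top_of_nonneg (by norm_num) (measure_ne_top _ _)
  have h2 : ‖hd.toLp (deriv φ)‖ ≤ ‖testToH01 a b φ‖ :=
    WithLp.norm_snd_le (L2 a b ℝ) (testToH1 a b φ).1
  have hK0 : 0 ≤ K := ENNReal.toReal_nonneg
  have h3 : ∀ᵐ x ∂μ, ‖testToL2mu μ a b φ x‖ ≤ ‖testToH01 a b φ‖ * K := by
    filter_upwards [MemLp.coeFn_toLp (φ.memLp 2 μ)] with x hx
    have hx' : testToL2mu μ a b φ x = φ x := hx
    rw [hx', Real.norm_eq_abs]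
    exact (φ.abs_le x).trans (h1.trans (mul_le_mul_of_nonneg_right h2 hK0))
  calc ‖testToL2mu μ a b φ‖ ≤ M * (‖testToH01 a b φ‖ * K) :=
        Lp.norm_le_of_ae_bound (by positivity) h3
    _ = M * K * ‖testToH01 a b φ‖ := by ring

/-- `iota` sends a test function to its class in `L²_μ`. -/
lemma iota_test (μ : Measure ℝ) [IsFiniteMeasure μ] {a b : ℝ} (φ : Test a b) :
    iota μ a b (testToH01 a b φ) = testToL2mu μ a b φ :=
  LinearMap.extendOfNorm_eq (denseRange_testToH01 a b) (exists_norm_testToL2mu_le μ a b) φ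

lemma energy_eq_inner {a b : ℝ} (u v : H01 a b) :
    energy u v = inner ℝ (weakDeriv v) (weakDeriv u) := by
  rw [L2.inner_def]
  rfl

/-- The domain of the form: the orthogonal complement in `H₀¹(a,b)`, with respect to the inner
product `∫ u' v' dx` of `H₀¹(a,b)`, of the null space `{v | ‖ι v‖_μ = 0}`. As a normed space it
carries the norm of `H¹(a,b)`, which on `H₀¹(a,b)` is equivalent to `(∫ |u'|² dx)^(1/2)`. -/
def DomE (μ : Measure ℝ) [IsFiniteMeasure μ] (a b : ℝ) : Submodule ℝ (H01 a b) where
  carrier := {u | ∀ v : H01 a b, ‖iota μ a b v‖ = 0 → energy u v = 0}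
  zero_mem' v _ := by
    rw [energy_eq_inner]
    exact inner_zero_right _
  add_mem' {u w} hu hw v hv := by
    have h1 := hu v hv
    have h2 := hw v hv
    rw [energy_eq_inner] at h1 h2 ⊢
    exact (inner_add_right _ _ _).trans ((congrArg₂ (· + ·) h1 h2).trans (add_zero 0))
  smul_mem' c u hu v hv := by
    have h1 := hu v hv
    rw [energy_eq_inner] at h1 ⊢
    exact (real_inner_smul_right _ _ _).trans ((congrArg (c * ·) h1).trans (mul_zero c))

/-! ### The Gelfand triple `Dom E ↪ L²_μ ≅ (L²_μ)' ↪ (Dom E)'` -/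

/-- The dual `(Dom E)'`. -/
abbrev DualE (μ : Measure ℝ) [IsFiniteMeasure μ] (a b : ℝ) : Type := StrongDual ℝ (DomE μ a b)

/-- The embedding `Dom E ↪ L²_μ`. -/
def toL2mu (μ : Measure ℝ) [IsFiniteMeasure μ] (a b : ℝ) : DomE μ a b →L[ℝ] L2mu μ :=
  (iota μ a b).comp (DomE μ a b).subtypeL

/-- The embedding `L²_μ ↪ (Dom E)'`, `w ↦ (w, ·)_μ`. -/
def toDualE (μ : Measure ℝ) [IsFiniteMeasure μ] (a b : ℝ) (w : L2mu μ) : DualE μ a b :=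
  (innerSL ℝ w).comp (toL2mu μ a b)

/-! ### Weak solutions -/

/-- `w : (0,T) → X` has a representative that is continuous on `[0,T]` with value `x₀` at `0`. -/
def HasInitialValue {X : Type*} [NormedAddCommGroup X] (T : ℝ) (w : ℝ → X) (x₀ : X) : Prop :=
  ∃ c : ℝ → X, ContinuousOn c (Icc 0 T) ∧ c =ᵐ[volume.restrict (Ioo 0 T)] w ∧ c 0 = x₀

/-- `u ∈ L²(0,T; Dom E)` is a weak solution of `u_tt - Δ_μ u = f` on `[a,b] × [0,T]` with Dirichlet
boundary conditions and initial data `u = g`, `u_t = h` at `t = 0`: there are weak derivatives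
`u_t ∈ L²(0,T; L²_μ)` and `u_tt ∈ L²(0,T; (Dom E)')` such that `⟨u_tt, v⟩ + E(u,v) = (f,v)_μ` for
every `v ∈ Dom E` and a.e. `t`, and the initial conditions hold for the continuous
representatives of `u` and of `u_t`, which take values in `L²_μ` and `(Dom E)'` respectively. -/
def IsWeakSolution (μ : Measure ℝ) [IsFiniteMeasure μ] (a b T : ℝ)
    (g : DomE μ a b) (h : L2mu μ) (f u : L2 0 T (DomE μ a b)) : Prop :=
  ∃ (ut : L2 0 T (L2mu μ)) (utt : L2 0 T (DualE μ a b)),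
    HasWeakDeriv 0 T (fun t => toL2mu μ a b (u t)) ut ∧
    HasWeakDeriv 0 T (fun t => toDualE μ a b (ut t)) utt ∧
    (∀ v : DomE μ a b, ∀ᵐ t ∂(volume.restrict (Ioo 0 T)),
      utt t v + energy (u t).1 v.1 = inner ℝ (toL2mu μ a b (f t)) (toL2mu μ a b v)) ∧
    HasInitialValue T (fun t => toL2mu μ a b (u t)) (toL2mu μ a b g) ∧
    HasInitialValue T (fun t => toDualE μ a b (ut t)) (toDualE μ a b h)

end FractalWave

end

noncomputable section

namespace FractalWave

/-! ### Primitives of integrable vector-valued functions on `(0,T)` -/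

section Primitive

variable {X : Type*} [NormedAddCommGroup X] [NormedSpace ℝ X] {T : ℝ}

/-! Write `V` for `DomE μ a b`, `H` for `L2mu μ`, `j` for the embedding `V → H` and `B` for the
energy. `V` is complete because it is closed in `H₀¹`, and the Poincaré inequality makes `B`
coercive on it. What remains is the abstract equation `j u'' + B u = j* f` with `f` valued in `H`.
By du Bois-Reymond, a weak derivative together with a continuous representative of given initial
value amounts to an integral identity. A weak solution is thus a pair `(u, v)` with `j u = j g + ∫
v` and `(v, j ·) = (h, j ·) + ∫ ((f, j ·) - B u)`.

Existence is by duality. Let `P`, `Q` be the primitives of `-ζ`, `-ξ` that vanish at `T`, and let `S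
: H → V` satisfy `B (S y) x = (y, j x)`. Pairing the two identities with `ξ` and `ζ` and using
Fubini gives the single equation `∫ B(u, P + S ξ) + ∫ (v, j ζ - Q) = (j g, Q 0) + (h, j (P 0)) + ∫
(f, j P)`. By Hahn-Banach and Riesz (`exists_forall_inner_eq`) it is solvable once the right side is
bounded by the `L²` norm of `(P + S ξ, j ζ - Q)`. Since `(j g, Q 0) = B (S (Q 0)) g`, it is enough
to bound `S Q` and `j P` uniformly in time; `exists_energy_estimate` does this through the energy of
one further primitive.

For uniqueness, `u_t` is not `V`-valued and cannot serve as a test function. With `w = ∫ u` and `W =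
∫ w`, the twice integrated equation can be tested with `w`, and `‖j w‖² + B W W` is conserved
(`ae_eq_zero_of_isPrimitive`). It starts at zero, so coercivity gives `W = 0` and hence `u = 0`. -/

lemma integrableOn_Icc_iff_restrict_Ioo {Y : Type*} [NormedAddCommGroup Y] {w : ℝ → Y} :
    IntegrableOn w (Icc 0 T) ↔ Integrable w (volume.restrict (Ioo 0 T)) :=
  integrableOn_Icc_iff_integrableOn_Ioo

lemma intervalIntegrable_of_integrable_restrict {Y : Type*} [NormedAddCommGroup Y]
    {w : ℝ → Y}
    (hw : Integrable w (volume.restrict (Ioo 0 T))) {s t : ℝ} (hs : s ∈ Icc 0 T)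
    (ht : t ∈ Icc 0 T) : IntervalIntegrable w volume s t := by
  have h : IntegrableOn w (Icc 0 T) := integrableOn_Icc_iff_restrict_Ioo.2 hw
  exact IntegrableOn.intervalIntegrable (h.mono_set (uIcc_subset_Icc hs ht))

lemma continuousOn_primitive_of_integrable_restrict {w : ℝ → X}
    (hw : Integrable w (volume.restrict (Ioo 0 T))) :
    ContinuousOn (fun t => ∫ s in (0 : ℝ)..t, w s) (Icc 0 T) := by
  rcases le_or_gt 0 T with hT | hT
  · have h := intervalIntegral.continuousOn_primitive_interval (μ := volume) (f := w) (a := 0)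
      (b := T) (by
        rw [uIcc_of_le hT]
        exact integrableOn_Icc_iff_restrict_Ioo.2 hw)
    rwa [uIcc_of_le hT] at h
  · rw [Icc_eq_empty hT.not_ge]
    exact continuousOn_empty _

lemma integrable_of_continuousOn_Icc {Y : Type*} [NormedAddCommGroup Y]
    {w : ℝ → Y} (hw : ContinuousOn w (Icc 0 T)) :
    Integrable w (volume.restrict (Ioo 0 T)) :=
  integrableOn_Icc_iff_restrict_Ioo.1 hw.integrableOn_Icc

lemma integrable_primitive {w : ℝ → X} (hw : Integrable w (volume.restrict (Ioo 0 T))) :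
    Integrable (fun t => ∫ s in (0 : ℝ)..t, w s) (volume.restrict (Ioo 0 T)) :=
  integrable_of_continuousOn_Icc (continuousOn_primitive_of_integrable_restrict hw)

lemma integrable_smul_of_continuous {φ : ℝ → ℝ} (hφ : Continuous φ) {w : ℝ → X}
    (hw : Integrable w (volume.restrict (Ioo 0 T))) :
    Integrable (fun t => φ t • w t) (volume.restrict (Ioo 0 T)) := by
  have h : IntegrableOn w (Icc 0 T) := integrableOn_Icc_iff_restrict_Ioo.2 hw
  exact integrableOn_Icc_iff_restrict_Ioo.1
    (h.continuousOn_smul hφ.continuousOn isCompact_Icc)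

/-- `w` is almost everywhere on `(0,T)` the primitive of `w'` with value `x₀` at `0`. -/
structure IsPrimitive (T : ℝ) (w w' : ℝ → X) (x₀ : X) : Prop where
  integrable_deriv : Integrable w' (volume.restrict (Ioo 0 T))
  ae_eq : ∀ᵐ t ∂volume.restrict (Ioo 0 T), w t = x₀ + ∫ s in (0 : ℝ)..t, w' s

lemma IsPrimitive.hasInitialValue {w w' : ℝ → X} {x₀ : X} (h : IsPrimitive T w w' x₀) :
    HasInitialValue T w x₀ :=
  ⟨fun t => x₀ + ∫ s in (0 : ℝ)..t, w' s,
    continuousOn_const.add (continuousOn_primitive_of_integrable_restrict h.integrable_deriv),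
    h.ae_eq.mono fun t ht => ht.symm, by simp⟩

variable [CompleteSpace X]

/-- Fubini's theorem on the triangle `0 < s < t < T`. -/
lemma integral_smul_primitive {φ : ℝ → ℝ} (hφ : Continuous φ) {w : ℝ → X}
    (hw : Integrable w (volume.restrict (Ioo 0 T))) :
    ∫ t in Ioo 0 T, φ t • ∫ s in (0 : ℝ)..t, w s =
      ∫ s in Ioo 0 T, (∫ t in s..T, φ t) • w s := by
  set ν := volume.restrict (Ioo 0 T) with hν
  have hφi : Integrable φ ν := integrable_of_continuousOn_Icc hφ.continuousOn
  have hm : MeasurableSet {p : ℝ × ℝ | p.2 ≤ p.1} := measurableSet_le measurable_snd measurable_fst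
  have hF : Integrable ({p : ℝ × ℝ | p.2 ≤ p.1}.indicator fun p => φ p.1 • w p.2) (ν.prod ν) :=
    (hφi.smul_prod hw).indicator hm
  have hsw := integral_integral_swap (f := fun t s =>
    {p : ℝ × ℝ | p.2 ≤ p.1}.indicator (fun p => φ p.1 • w p.2) (t, s)) hF
  have h1 : ∫ t in Ioo 0 T, φ t • ∫ s in (0 : ℝ)..t, w s = ∫ t, ∫ s,
      {p : ℝ × ℝ | p.2 ≤ p.1}.indicator (fun p => φ p.1 • w p.2) (t, s) ∂ν ∂ν := by
    refine setIntegral_congr_fun measurableSet_Ioo fun t ht => ?_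
    have e : ∀ s, {p : ℝ × ℝ | p.2 ≤ p.1}.indicator (fun p => φ p.1 • w p.2) (t, s) =
        φ t • (Iic t).indicator w s := by
      intro s
      by_cases hs : s ≤ t <;> simp [indicator, hs]
    simp only [e]
    rw [integral_smul, integral_indicator measurableSet_Iic, hν,
      Measure.restrict_restrict measurableSet_Iic, intervalIntegral.integral_of_le ht.1.le]
    congr 3
    ext s
    simp only [mem_Ioc, mem_inter_iff, mem_Iic, mem_Ioo]
    exact ⟨fun h => ⟨h.2, h.1, h.2.trans_lt ht.2⟩, fun h => ⟨h.2.1, h.1⟩⟩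
  have h2 : ∫ s in Ioo 0 T, (∫ t in s..T, φ t) • w s = ∫ s, ∫ t,
      {p : ℝ × ℝ | p.2 ≤ p.1}.indicator (fun p => φ p.1 • w p.2) (t, s) ∂ν ∂ν := by
    refine setIntegral_congr_fun measurableSet_Ioo fun s hs => ?_
    have e : ∀ t, {p : ℝ × ℝ | p.2 ≤ p.1}.indicator (fun p => φ p.1 • w p.2) (t, s) =
        (Ici s).indicator φ t • w s := by
      intro t
      by_cases hs : s ≤ t <;> simp [indicator, hs]
    simp only [e]
    rw [integral_smul_const, integral_indicator measurableSet_Ici, hν,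
      Measure.restrict_restrict measurableSet_Ici, intervalIntegral.integral_of_le hs.2.le,
      integral_Ioc_eq_integral_Ioo, ← integral_Ico_eq_integral_Ioo]
    congr 3
    ext t
    simp only [mem_Ico, mem_inter_iff, mem_Ici, mem_Ioo]
    exact ⟨fun h => ⟨h.1, hs.1.trans_le h.1, h.2⟩, fun h => ⟨h.1, h.2.2⟩⟩
  rw [h1, h2, hsw]

/-- The fundamental lemma of the calculus of variations. -/
lemma ae_eq_zero_of_forall_test {w : ℝ → X}
    (hw : Integrable w (volume.restrict (Ioo 0 T)))
    (h : ∀ φ : Test 0 T, ∫ t in Ioo 0 T, φ t • w t = 0) :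
    w =ᵐ[volume.restrict (Ioo 0 T)] 0 := by
  have key := isOpen_Ioo.ae_eq_zero_of_integral_contDiff_smul_eq_zero (f := w) (μ := volume)
    (U := Ioo 0 T) (IntegrableOn.locallyIntegrableOn hw) ?_
  · exact (ae_restrict_iff' measurableSet_Ioo).2 key
  · intro g hg hc hs
    have := h ⟨g, hg, hc, hs⟩
    rw [← this]
    refine (setIntegral_eq_integral_of_forall_compl_eq_zero fun x hx => ?_).symm
    have : g x = 0 := by
      by_contra h0
      exact hx (hs (subset_tsupport _ h0))
    simp [this]

/-- A test function with zero mean is the derivative of a test function. -/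
lemma Test.exists_deriv_eq (θ : Test 0 T) (h0 : ∫ t in (0 : ℝ)..T, θ t = 0) :
    ∃ Φ : Test 0 T, ∀ t, deriv Φ t = θ t := by
  obtain ⟨c, d, hc, hd, hcd⟩ : ∃ c d : ℝ, 0 < c ∧ d < T ∧ ∀ t, θ t ≠ 0 → t ∈ Icc c d := by
    rcases (tsupport θ).eq_empty_or_nonempty with he | hne
    · refine ⟨1, T - 1, one_pos, by linarith, fun t ht => ?_⟩
      have := subset_tsupport _ (show t ∈ Function.support θ from ht)
      simp [he] at this
    · have hK : IsCompact (tsupport θ) := θ.hasCompactSupport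
      obtain ⟨c, hc⟩ := hK.exists_isLeast hne
      obtain ⟨d, hd⟩ := hK.exists_isGreatest hne
      refine ⟨c, d, (θ.tsupport_subset hc.1).1, (θ.tsupport_subset hd.1).2, fun t ht => ?_⟩
      have := subset_tsupport _ (show t ∈ Function.support θ from ht)
      exact ⟨hc.2 this, hd.2 this⟩
  have hθc : Continuous θ := θ.continuous
  have hder : ∀ t, HasDerivAt (fun t => ∫ s in (0 : ℝ)..t, θ s) (θ t) t := fun t =>
    intervalIntegral.integral_hasDerivAt_right (hθc.intervalIntegrable _ _)
      hθc.stronglyMeasurable.stronglyMeasurableAtFilter hθc.continuousAt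
  have hsupp : Function.support (fun t => ∫ s in (0 : ℝ)..t, θ s) ⊆ Icc c d := by
    intro t ht
    by_contra hn
    apply ht
    rw [mem_Icc, not_and_or, not_le, not_le] at hn
    rcases hn with hn | hn
    · refine intervalIntegral.integral_zero_ae (Filter.Eventually.of_forall fun s hs => ?_)
      by_contra hne
      have h1 := (hcd s hne).1
      have h2 : s ≤ max 0 t := hs.2
      exact absurd (h1.trans h2) (not_le.2 (max_lt hc hn))
    -- To the right of `d` the zero mean enters: the integral up to `T` is zero, and `θ` vanishes
    -- between `T` and `t`.
    · have h1 := intervalIntegral.integral_add_adjacent_intervals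
        (hθc.intervalIntegrable (μ := volume) 0 T) (hθc.intervalIntegrable T t)
      rw [h0, zero_add] at h1
      simp only
      rw [← h1]
      refine intervalIntegral.integral_zero_ae (Filter.Eventually.of_forall fun s hs => ?_)
      by_contra hne
      have h1 := (hcd s hne).2
      have h2 : min T t < s := hs.1
      exact absurd (h2.trans_le h1) (not_lt.2 (le_min hd.le hn.le))
  have htsupp := closure_minimal hsupp isClosed_Icc
  refine ⟨⟨fun t => ∫ s in (0 : ℝ)..t, θ s, ?_, ?_, ?_⟩, fun t => (hder t).deriv⟩
  · have : ContDiff ℝ ((⊤ : ℕ∞) + 1) (fun t => ∫ s in (0 : ℝ)..t, θ s) := by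
      refine contDiff_succ_iff_deriv.2 ⟨fun t => (hder t).differentiableAt, by simp, ?_⟩
      rw [show deriv (fun t => ∫ s in (0 : ℝ)..t, θ s) = θ from funext fun t => (hder t).deriv]
      exact θ.contDiff
    simpa using this
  · exact HasCompactSupport.of_support_subset_isCompact isCompact_Icc hsupp
  · intro t ht
    have := htsupp ht
    exact ⟨hc.trans_le this.1, this.2.trans_lt hd⟩

lemma Test.integral_deriv_right (φ : Test 0 T) (s : ℝ) : ∫ t in s..T, deriv φ t = -φ s := by
  have h := intervalIntegral.integral_eq_sub_of_hasDerivAt (a := s) (b := T)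
    (fun t _ => φ.hasDerivAt t) (φ.contDiff_deriv.continuous.intervalIntegrable _ _)
  rw [h, φ.eq_zero (x := T) (by simp), zero_sub]

/-- The lemma of du Bois-Reymond. -/
lemma exists_ae_eq_const_of_forall_test (hT : 0 < T) {w : ℝ → X}
    (hw : Integrable w (volume.restrict (Ioo 0 T)))
    (h : ∀ φ : Test 0 T, ∫ t in Ioo 0 T, deriv φ t • w t = 0) :
    ∃ m : X, w =ᵐ[volume.restrict (Ioo 0 T)] fun _ => m := by
  have hint : ∀ φ : Test 0 T, ∫ t in (0 : ℝ)..T, φ t = ∫ t in Ioo 0 T, φ t := fun φ => by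
    rw [intervalIntegral.integral_of_le hT.le, integral_Ioc_eq_integral_Ioo]
  -- If every test function had zero mean, the fundamental lemma would make the constant `1` vanish
  -- almost everywhere.
  obtain ⟨ψ, hψ⟩ : ∃ ψ : Test 0 T, ∫ t in Ioo 0 T, ψ t ≠ 0 := by
    by_contra! hc
    have h1 := ae_eq_zero_of_forall_test (T := T) (w := fun _ => (1 : ℝ)) (integrable_const _)
      (by simpa using hc)
    have h2 : volume.restrict (Ioo 0 T) univ = 0 := by
      have h3 : ∀ᵐ t ∂volume.restrict (Ioo 0 T), False := h1.mono fun t ht => by simp at ht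
      simpa only [not_false_eq_true, ofPred_true] using ae_iff.1 h3
    rw [Measure.restrict_apply_univ, Real.volume_Ioo, ENNReal.ofReal_eq_zero] at h2
    linarith
  set I : ℝ := ∫ t in Ioo 0 T, ψ t with hI
  refine ⟨I⁻¹ • ∫ t in Ioo 0 T, ψ t • w t, ?_⟩
  have key := ae_eq_zero_of_forall_test (T := T)
    (w := fun t => w t - I⁻¹ • ∫ t in Ioo 0 T, ψ t • w t) (hw.sub (integrable_const _)) fun χ => by
      -- Subtracting a multiple of `ψ` removes the mean of `I • χ`, so the hypothesis on derivatives
      -- applies to the difference.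
      obtain ⟨Φ, hΦ⟩ := Test.exists_deriv_eq (I • χ - (∫ t in Ioo 0 T, χ t) • ψ) (by
        have e : ∀ t, (I • χ - (∫ t in Ioo 0 T, χ t) • ψ : Test 0 T) t =
          I * χ t - (∫ t in Ioo 0 T, χ t) * ψ t := fun t => rfl
        simp only [e]
        rw [intervalIntegral.integral_sub ((χ.continuous.const_mul I).intervalIntegrable _ _)
          ((ψ.continuous.const_mul _).intervalIntegrable _ _),
          intervalIntegral.integral_const_mul, intervalIntegral.integral_const_mul, hint, hint]
        ring)
      have h1 := h Φ
      have e : ∀ t, deriv Φ t • w t = I • (χ t • w t) - (∫ t in Ioo 0 T, χ t) • (ψ t • w t) := by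
        intro t
        rw [hΦ t, smul_smul, smul_smul, ← sub_smul]
        rfl
      simp only [e] at h1
      rw [integral_sub (f := fun t => I • (χ t • w t))
          (g := fun t => (∫ t in Ioo 0 T, χ t) • (ψ t • w t))
          ((χ.integrable_smul hw).smul _) ((ψ.integrable_smul hw).smul _),
        integral_smul, integral_smul, sub_eq_zero] at h1
      simp only [smul_sub]
      rw [integral_sub (χ.integrable_smul hw) (χ.integrable_smul (integrable_const _)),
        integral_smul_const, smul_comm, ← h1, smul_smul, inv_mul_cancel₀ hψ, one_smul, sub_self]
  filter_upwards [key] with t ht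
  exact sub_eq_zero.1 ht

/-- Fubini moves the inner integral onto `φ'`, whose integral from `s` to `T` is `-φ s`; the
constant `x₀` drops out because `φ'` has zero mean. -/
lemma IsPrimitive.hasWeakDeriv {w w' : ℝ → X} {x₀ : X} (h : IsPrimitive T w w' x₀) :
    HasWeakDeriv 0 T w w' := by
  have hp := integrable_primitive h.integrable_deriv
  refine ⟨((integrable_const x₀).add hp).congr (h.ae_eq.mono fun t ht => ht.symm),
    h.integrable_deriv, fun φ => ?_⟩
  rw [integral_congr_ae (h.ae_eq.mono fun t ht => by simp only [ht] :
    (fun t => deriv φ t • w t) =ᵐ[volume.restrict (Ioo 0 T)]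
      fun t => deriv φ t • (x₀ + ∫ s in (0 : ℝ)..t, w' s))]
  simp only [smul_add]
  rw [integral_add (φ.integrable_deriv_smul (integrable_const _)) (φ.integrable_deriv_smul hp),
    integral_smul_primitive φ.contDiff_deriv.continuous h.integrable_deriv]
  simp only [φ.integral_deriv_right, neg_smul]
  rw [integral_neg, integral_smul_const]
  have h0 : ∫ t in Ioo 0 T, deriv φ t = 0 := by
    rcases le_or_gt 0 T with hT | hT
    · rw [← integral_Ioc_eq_integral_Ioo, ← intervalIntegral.integral_of_le hT,
        φ.integral_deriv_right, φ.eq_zero (by simp), neg_zero]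
    · simp [Ioo_eq_empty hT.not_gt]
  rw [h0, zero_smul, zero_add]

/-- By du Bois-Reymond the weak derivative determines `w` up to a constant, and the initial value of
the continuous representative fixes that constant. -/
lemma HasWeakDeriv.isPrimitive (hT : 0 < T) {w w' : ℝ → X} {x₀ : X}
    (h : HasWeakDeriv 0 T w w') (h₀ : HasInitialValue T w x₀) : IsPrimitive T w w' x₀ := by
  obtain ⟨c, hc, hcw, rfl⟩ := h₀
  have hp := integrable_primitive h.integrable_deriv
  have hpc := continuousOn_primitive_of_integrable_restrict h.integrable_deriv
  obtain ⟨m, hm⟩ := exists_ae_eq_const_of_forall_test hT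
    (w := fun t => w t - ∫ s in (0 : ℝ)..t, w' s) (h.integrable.sub hp) fun φ => by
      simp only [smul_sub]
      rw [integral_sub (φ.integrable_deriv_smul h.integrable) (φ.integrable_deriv_smul hp),
        integral_smul_primitive φ.contDiff_deriv.continuous h.integrable_deriv, h.integral_eq]
      simp only [φ.integral_deriv_right, neg_smul]
      rw [integral_neg, sub_self]
  -- Continuity upgrades the almost everywhere identity to all of `[0, T]`, so that it can be
  -- evaluated at `0`.
  have heq : EqOn (fun t => c t - ∫ s in (0 : ℝ)..t, w' s) (fun _ => m) (Icc 0 T) := by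
    refine Measure.eqOn_Icc_of_ae_eq volume hT.ne ?_ (hc.sub hpc) continuousOn_const
    rw [← restrict_Ioo_eq_restrict_Icc]
    filter_upwards [hm, hcw] with t h1 h2
    rw [h2]
    exact h1
  have h0 : c 0 = m := by
    simpa using heq (left_mem_Icc.2 hT.le)
  refine ⟨h.integrable_deriv, hm.mono fun t ht => ?_⟩
  rw [h0]
  exact sub_eq_iff_eq_add.1 ht

/-- A weak characterisation of primitives. -/
lemma isPrimitive_of_forall_test {w w' : ℝ → X} {x₀ : X}
    (hw : Integrable w (volume.restrict (Ioo 0 T)))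
    (hw' : Integrable w' (volume.restrict (Ioo 0 T)))
    (h : ∀ φ : Test 0 T, ∫ t in Ioo 0 T, φ t • w t =
      (∫ t in Ioo 0 T, φ t) • x₀ + ∫ s in Ioo 0 T, (∫ t in s..T, φ t) • w' s) :
    IsPrimitive T w w' x₀ := by
  have hp := integrable_primitive hw'
  have key := ae_eq_zero_of_forall_test (T := T)
    (w := fun t => w t - (x₀ + ∫ s in (0 : ℝ)..t, w' s))
    (hw.sub ((integrable_const _).add hp)) fun φ => by
      have hφ := φ.continuous
      simp only [smul_sub, smul_add]
      rw [integral_sub (g := fun t => φ t • x₀ + φ t • ∫ s in (0 : ℝ)..t, w' s)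
          (φ.integrable_smul hw)
          ((φ.integrable_smul (integrable_const _)).add (φ.integrable_smul hp)),
        integral_add (φ.integrable_smul (integrable_const _)) (φ.integrable_smul hp),
        integral_smul_primitive hφ hw', integral_smul_const, h, sub_self]
  exact ⟨hw', key.mono fun t ht => sub_eq_zero.1 ht⟩

end Primitive

/-! ### An abstract second-order evolution equation

For a symmetric coercive form `B` on `V` and a bounded map `j : V → H`, existence follows by
duality from an energy estimate for the adjoint problem, and uniqueness from the energy identity of
the twice integrated equation. Neither density nor compactness of `j` plays a role, so that the
main theorem does not need the support and atom conditions on `μ`. -/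

/-- An a priori bound `|ℓ y| ≤ C ‖R y‖` makes the variational problem `⟪x, R y⟫ = ℓ y`
solvable. -/
lemma exists_forall_inner_eq {X Y : Type*} [NormedAddCommGroup X] [InnerProductSpace ℝ X]
    [CompleteSpace X] [AddCommGroup Y] [Module ℝ Y] (R : Y →ₗ[ℝ] X) (ℓ : Y →ₗ[ℝ] ℝ) (C : ℝ)
    (h : ∀ y, |ℓ y| ≤ C * ‖R y‖) : ∃ x : X, ∀ y, inner ℝ x (R y) = ℓ y := by
  -- The bound forces `ℓ` to vanish on the kernel of `R`. So `ℓ` descends to a bounded functional on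
  -- the range, which Hahn-Banach extends and Riesz represents.
  have hker : LinearMap.ker R ≤ LinearMap.ker ℓ := fun y hy => by
    have h1 := h y
    rw [LinearMap.mem_ker.1 hy, norm_zero, mul_zero] at h1
    exact LinearMap.mem_ker.2 (abs_nonpos_iff.1 h1)
  set L : LinearMap.range R →ₗ[ℝ] ℝ :=
    ((LinearMap.ker R).liftQ ℓ hker).comp R.quotKerEquivRange.symm.toLinearMap with hL
  have hLR : ∀ y, L ⟨R y, LinearMap.mem_range_self R y⟩ = ℓ y := fun y => by
    have : R.quotKerEquivRange.symm ⟨R y, LinearMap.mem_range_self R y⟩ =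
        (LinearMap.ker R).mkQ y := R.quotKerEquivRange_symm_apply_image y _
    simp [hL, this]
  obtain ⟨G, hG, -⟩ := exists_extension_norm_eq (LinearMap.range R)
    (L.mkContinuous C (by
      rintro ⟨_, y, rfl⟩
      rw [hLR]
      exact h y))
  refine ⟨(InnerProductSpace.toDual ℝ X).symm G, fun y => ?_⟩
  rw [InnerProductSpace.toDual_symm_apply]
  exact (hG ⟨R y, LinearMap.mem_range_self R y⟩).trans (hLR y)

/-! ### Continuous functions, their primitives vanishing at `T`, and their `L²` classes. -/

section Primitive

lemma memLp_of_continuousMap {Y : Type*} [NormedAddCommGroup Y] (φ : C(ℝ, Y)) (T : ℝ) :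
    MemLp φ 2 (volume.restrict (Ioo 0 T)) := by
  obtain ⟨C, hC⟩ := isCompact_Icc.exists_bound_of_continuousOn
    (φ.continuous.continuousOn (s := Icc 0 T))
  refine MemLp.of_bound φ.continuous.aestronglyMeasurable C ?_
  filter_upwards [ae_restrict_mem measurableSet_Ioo] with t ht
  exact hC t (Ioo_subset_Icc_self ht)

variable {X : Type*} [NormedAddCommGroup X] [NormedSpace ℝ X]

lemma norm_tail_le {w : ℝ → X} (hw : Continuous w) {T t : ℝ} (ht : t ∈ Icc 0 T) :
    ‖∫ s in t..T, w s‖ ≤ ∫ s in (0 : ℝ)..T, ‖w s‖ := by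
  refine (intervalIntegral.norm_integral_le_integral_norm ht.2).trans ?_
  exact intervalIntegral.integral_mono_interval ht.1 ht.2 le_rfl
    (Filter.Eventually.of_forall fun s => norm_nonneg _) (hw.norm.intervalIntegrable _ _)

variable [CompleteSpace X]

lemma hasDerivAt_tail {w : ℝ → X} (hw : Continuous w) (T t : ℝ) :
    HasDerivAt (fun t => ∫ s in t..T, w s) (-w t) t :=
  intervalIntegral.integral_hasDerivAt_left (hw.intervalIntegrable _ _)
    hw.stronglyMeasurable.stronglyMeasurableAtFilter hw.continuousAt

lemma eq_tail_of_hasDerivAt {w w' : ℝ → X} {T : ℝ} (h : ∀ t, HasDerivAt w (-w' t) t)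
    (hw' : Continuous w') (h0 : w T = 0) (t : ℝ) : w t = ∫ s in t..T, w' s := by
  have h1 := intervalIntegral.integral_eq_sub_of_hasDerivAt (a := t) (b := T)
    (fun s _ => h s) (hw'.neg.intervalIntegrable _ _)
  rw [intervalIntegral.integral_neg, h0, zero_sub, neg_inj] at h1
  exact h1.symm

/-- The primitive vanishing at `T`, up to sign. -/
def tail (X : Type*) [NormedAddCommGroup X] [NormedSpace ℝ X] [CompleteSpace X] (T : ℝ) :
    C(ℝ, X) →ₗ[ℝ] C(ℝ, X) where
  toFun φ := ⟨fun t => ∫ s in t..T, φ s,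
    continuous_iff_continuousAt.2 fun t => (hasDerivAt_tail φ.continuous T t).continuousAt⟩
  map_add' φ ψ := by
    ext t
    exact intervalIntegral.integral_add (φ.continuous.intervalIntegrable _ _)
      (ψ.continuous.intervalIntegrable _ _)
  map_smul' c φ := by
    ext t
    exact intervalIntegral.integral_smul c φ

/-- The class of a continuous function in `L²(0,T;X)`. -/
def contToL2 (X : Type*) [NormedAddCommGroup X] [NormedSpace ℝ X] [CompleteSpace X] (T : ℝ) :
    C(ℝ, X) →ₗ[ℝ] L2 0 T X where
  toFun φ := (memLp_of_continuousMap φ T).toLp φ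
  map_add' φ ψ := MemLp.toLp_add (memLp_of_continuousMap φ T) (memLp_of_continuousMap ψ T)
  map_smul' c φ := MemLp.toLp_const_smul c (memLp_of_continuousMap φ T)

lemma coeFn_contToL2 (φ : C(ℝ, X)) (T : ℝ) :
    contToL2 X T φ =ᵐ[volume.restrict (Ioo 0 T)] φ :=
  MemLp.coeFn_toLp (memLp_of_continuousMap φ T)

/-- Hölder's inequality on a finite measure. The energy estimate is in `L¹` norms in time, while the
Riesz argument needs `L²`. -/
lemma exists_integral_norm_le_contToL2 (X : Type*) [NormedAddCommGroup X] [NormedSpace ℝ X]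
    [CompleteSpace X] {T : ℝ} (hT : 0 < T) :
    ∃ K, 0 ≤ K ∧ ∀ φ : C(ℝ, X), ∫ t in (0 : ℝ)..T, ‖φ t‖ ≤ K * ‖contToL2 X T φ‖ := by
  set ν := volume.restrict (Ioo 0 T) with hν
  refine ⟨((ν univ) ^ (1 / (1 : ℝ≥0∞).toReal - 1 / (2 : ℝ≥0∞).toReal)).toReal,
    ENNReal.toReal_nonneg, fun φ => ?_⟩
  have hd := memLp_of_continuousMap φ T
  have e1 : ∫ t in (0 : ℝ)..T, ‖φ t‖ = (eLpNorm φ 1 ν).toReal := by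
    rw [eLpNorm_one_eq_lintegral_enorm, ← integral_norm_eq_lintegral_enorm hd.1,
      intervalIntegral.integral_of_le hT.le, integral_Ioc_eq_integral_Ioo]
  have e2 : ‖contToL2 X T φ‖ = (eLpNorm φ 2 ν).toReal := Lp.norm_toLp _ hd
  rw [e1, e2, mul_comm, ← ENNReal.toReal_mul]
  refine ENNReal.toReal_mono (ENNReal.mul_ne_top hd.2.ne ?_)
    (eLpNorm_le_eLpNorm_mul_rpow_measure_univ (by norm_num) hd.1)
  exact ENNReal.rpow_ne_top_of_nonneg (by norm_num) (measure_ne_top _ _)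

lemma exists_norm_contToL2_le (X : Type*) [NormedAddCommGroup X] [NormedSpace ℝ X]
    [CompleteSpace X] (T : ℝ) :
    ∃ K, 0 ≤ K ∧ ∀ (φ : C(ℝ, X)) (M : ℝ), 0 ≤ M → (∀ t ∈ Icc 0 T, ‖φ t‖ ≤ M) →
      ‖contToL2 X T φ‖ ≤ K * M := by
  refine ⟨(measureUnivNNReal (volume.restrict (Ioo 0 T)) : ℝ) ^ (2 : ℝ≥0∞).toReal⁻¹,
    by positivity, fun φ M hM hφ => Lp.norm_le_of_ae_bound hM ?_⟩
  filter_upwards [coeFn_contToL2 φ T, ae_restrict_mem measurableSet_Ioo] with t h1 h2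
  rw [h1]
  exact hφ t (Ioo_subset_Icc_self h2)

end Primitive

/-! ### The a priori estimate for the adjoint problem. -/

section Abstract

variable {V H : Type*} [NormedAddCommGroup V] [InnerProductSpace ℝ V] [CompleteSpace V]
  [NormedAddCommGroup H] [InnerProductSpace ℝ H] [CompleteSpace H]
  {j : V →L[ℝ] H} {B : V →L[ℝ] V →L[ℝ] ℝ} {S : H →L[ℝ] V} {T : ℝ}

/-- The energy estimate for the adjoint problem, integrated once in time. -/
lemma exists_energy_estimate (hB : IsCoercive B) (hsymm : ∀ x y, B x y = B y x)
    (hS : ∀ y x, B (S y) x = inner ℝ y (j x)) (hT : 0 < T) :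
    ∃ K, 0 ≤ K ∧ ∀ (P₁ P ζ : ℝ → V) (Q₁ Q ξ : ℝ → H),
      (∀ t, HasDerivAt P₁ (-P t) t) → (∀ t, HasDerivAt P (-ζ t) t) → Continuous ζ →
      (∀ t, HasDerivAt Q₁ (-Q t) t) → (∀ t, HasDerivAt Q (-ξ t) t) → Continuous ξ →
      P₁ T = 0 → P T = 0 → Q₁ T = 0 → Q T = 0 → ∀ t ∈ Icc 0 T,
      ‖S (Q t)‖ ≤ K * ((∫ s in (0 : ℝ)..T, ‖P s + S (ξ s)‖) +
        ∫ s in (0 : ℝ)..T, ‖j (ζ s) - Q s‖) ∧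
      ‖j (P t)‖ ≤ K * ((∫ s in (0 : ℝ)..T, ‖P s + S (ξ s)‖) +
        ∫ s in (0 : ℝ)..T, ‖j (ζ s) - Q s‖) := by
  obtain ⟨c, hc, hcoer⟩ := hB
  -- One constant that bounds both parts of the energy from below: `c` serves for `B` and `1` for
  -- the norm of `H`.
  set d := min c 1 with hd
  have hd0 : 0 < d := lt_min hc one_pos
  have hBn : 0 ≤ ‖B‖ := B.opNorm_nonneg
  set K₀ := 8 * (‖B‖ + 1) / d with hK₀
  have hK₀0 : 0 ≤ K₀ := by positivity
  refine ⟨K₀ + 1, by positivity, ?_⟩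
  intro P₁ P ζ Q₁ Q ξ hP₁ hP hζ hQ₁ hQ hξ hP₁T hPT hQ₁T hQT
  have hPc : Continuous P := continuous_iff_continuousAt.2 fun t => (hP t).continuousAt
  have hQc : Continuous Q := continuous_iff_continuousAt.2 fun t => (hQ t).continuousAt
  have hP₁c : Continuous P₁ := continuous_iff_continuousAt.2 fun t => (hP₁ t).continuousAt
  have hQ₁c : Continuous Q₁ := continuous_iff_continuousAt.2 fun t => (hQ₁ t).continuousAt
  set α : ℝ → V := fun t => P t + S (ξ t) with hα
  set β : ℝ → H := fun t => j (ζ t) - Q t with hβ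
  have hαc : Continuous α := hPc.add (S.continuous.comp hξ)
  have hβc : Continuous β := (j.continuous.comp hζ).sub hQc
  set N := (∫ s in (0 : ℝ)..T, ‖α s‖) + ∫ s in (0 : ℝ)..T, ‖β s‖ with hN
  have hNα : 0 ≤ ∫ s in (0 : ℝ)..T, ‖α s‖ :=
    intervalIntegral.integral_nonneg hT.le fun s _ => norm_nonneg _
  have hNβ : 0 ≤ ∫ s in (0 : ℝ)..T, ‖β s‖ :=
    intervalIntegral.integral_nonneg hT.le fun s _ => norm_nonneg _
  have hN0 : 0 ≤ N := add_nonneg hNα hNβ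
  -- `α₁` and `β₁` are the primitives of `α` and `β` vanishing at `T`, hence at most `N` in norm on
  -- `[0, T]`.
  set α₁ : ℝ → V := fun t => P₁ t + S (Q t) with hα₁
  set β₁ : ℝ → H := fun t => j (P t) - Q₁ t with hβ₁
  have hα₁d : ∀ t, HasDerivAt α₁ (-α t) t := fun t => by
    have h := (hP₁ t).add (S.hasFDerivAt.comp_hasDerivAt t (hQ t))
    rw [map_neg, ← neg_add] at h
    exact h
  have hβ₁d : ∀ t, HasDerivAt β₁ (-β t) t := fun t => by
    have h := (j.hasFDerivAt.comp_hasDerivAt t (hP t)).sub (hQ₁ t)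
    rw [map_neg, ← neg_sub'] at h
    exact h
  have hα₁N : ∀ t ∈ Icc 0 T, ‖α₁ t‖ ≤ N := fun t ht => by
    rw [eq_tail_of_hasDerivAt (T := T) hα₁d hαc (by simp [hα₁, hP₁T, hQT]) t]
    exact (norm_tail_le hαc ht).trans (le_add_of_nonneg_right hNβ)
  have hβ₁N : ∀ t ∈ Icc 0 T, ‖β₁ t‖ ≤ N := fun t ht => by
    rw [eq_tail_of_hasDerivAt (T := T) hβ₁d hβc (by simp [hβ₁, hPT, hQ₁T]) t]
    exact (norm_tail_le hβc ht).trans (le_add_of_nonneg_left hNα)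
  -- the energy identity
  have hid : ∀ t, (B (P₁ t) (P₁ t) + inner ℝ (Q₁ t) (Q₁ t)) / 2 =
      B (P₁ t) (α₁ t) - inner ℝ (Q₁ t) (β₁ t) -
        ∫ s in t..T, (B (P₁ s) (α s) - inner ℝ (Q₁ s) (β s)) := by
    intro t
    -- Substituting `α₁` and `β₁` into the derivative of the energy cancels the cross terms `(Q, j
    -- P)` and leaves `-B P α₁ + (Q, β₁)`. As `P` and `Q` are not controlled, the correction terms
    -- integrate by parts in time, so that only `P₁` and `Q₁` meet `α` and `β`.
    have hder : ∀ t, HasDerivAt (fun t => (B (P₁ t) (P₁ t) + inner ℝ (Q₁ t) (Q₁ t)) / 2 -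
        B (P₁ t) (α₁ t) + inner ℝ (Q₁ t) (β₁ t))
        (-(-(B (P₁ t) (α t) - inner ℝ (Q₁ t) (β t)))) t := by
      intro t
      have h1 := B.hasDerivAt_of_bilinear (fun _ => hP₁ t) (fun _ => hP₁ t)
      have h2 := (hQ₁ t).inner ℝ (hQ₁ t)
      have h3 := B.hasDerivAt_of_bilinear (fun _ => hP₁ t) (fun _ => hα₁d t)
      have h4 := (hQ₁ t).inner ℝ (hβ₁d t)
      refine ((((h1.add h2).div_const 2).sub h3).add h4).congr_deriv ?_
      have e1 : B (P t) (α₁ t) = B (P t) (P₁ t) + inner ℝ (Q t) (j (P t)) := by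
        simp only [hα₁, map_add]
        rw [hsymm (P t) (S (Q t)), hS]
      have e2 : inner ℝ (Q t) (β₁ t) = inner ℝ (Q t) (j (P t)) - inner ℝ (Q t) (Q₁ t) :=
        inner_sub_right _ _ _
      simp only [map_neg, neg_apply, inner_neg_left, inner_neg_right, e1, e2, hsymm (P₁ t) (P t),
        real_inner_comm (Q t) (Q₁ t)]
      ring
    have hint : Continuous fun s => B (P₁ s) (α s) - inner ℝ (Q₁ s) (β s) :=
      ((B.continuous.comp hP₁c).clm_apply hαc).sub (hQ₁c.inner hβc)
    have h := eq_tail_of_hasDerivAt (T := T) hder hint.neg (by simp [hP₁T, hQ₁T]) t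
    rw [intervalIntegral.integral_neg] at h
    linarith
  have hcont : Continuous fun t => ‖P₁ t‖ + ‖Q₁ t‖ := hP₁c.norm.add hQ₁c.norm
  -- At a maximum point `τ` the energy is at least a multiple of `m ^ 2`, while the identity bounds
  -- it by a multiple of `m * N`. Cancelling `m` gives `m ≤ K₀ * N`; the `8` in `K₀` is the `2` of
  -- the upper bound times the `4` of the lower one.
  obtain ⟨τ, hτ, hmax⟩ := isCompact_Icc.exists_isMaxOn (nonempty_Icc.2 hT.le)
    (hcont.continuousOn (s := Icc 0 T))
  set m := ‖P₁ τ‖ + ‖Q₁ τ‖ with hm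
  have hle : ∀ t ∈ Icc 0 T, ‖P₁ t‖ + ‖Q₁ t‖ ≤ m := fun t ht => hmax ht
  have hm0 : 0 ≤ m := by positivity
  have hPm : ∀ t ∈ Icc 0 T, ‖P₁ t‖ ≤ m := fun t ht =>
    (le_add_of_nonneg_right (norm_nonneg _)).trans (hle t ht)
  have hQm : ∀ t ∈ Icc 0 T, ‖Q₁ t‖ ≤ m := fun t ht =>
    (le_add_of_nonneg_left (norm_nonneg _)).trans (hle t ht)
  have hbd : ∀ t ∈ Icc 0 T, ∀ x y, ‖B (P₁ t) x - inner ℝ (Q₁ t) y‖ ≤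
      (‖B‖ * m) * ‖x‖ + m * ‖y‖ := fun t ht x y => by
    refine (norm_sub_le _ _).trans (add_le_add ?_ ?_)
    · exact (B.le_opNorm₂ _ _).trans (mul_le_mul_of_nonneg_right
        (mul_le_mul_of_nonneg_left (hPm t ht) hBn) (norm_nonneg _))
    · exact (norm_inner_le_norm _ _).trans
        (mul_le_mul_of_nonneg_right (hQm t ht) (norm_nonneg _))
  have hupper : (B (P₁ τ) (P₁ τ) + inner ℝ (Q₁ τ) (Q₁ τ)) / 2 ≤ 2 * (‖B‖ + 1) * m * N := by
    rw [hid τ]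
    have h1 : B (P₁ τ) (α₁ τ) - inner ℝ (Q₁ τ) (β₁ τ) ≤ (‖B‖ * m) * N + m * N := by
      refine (Real.le_norm_self _).trans ((hbd τ hτ _ _).trans (add_le_add ?_ ?_))
      · exact mul_le_mul_of_nonneg_left (hα₁N τ hτ) (by positivity)
      · exact mul_le_mul_of_nonneg_left (hβ₁N τ hτ) hm0
    have hgc : Continuous fun s => (‖B‖ * m) * ‖α s‖ + m * ‖β s‖ :=
      (hαc.norm.const_mul _).add (hβc.norm.const_mul _)
    have h2 : ‖∫ s in τ..T, (B (P₁ s) (α s) - inner ℝ (Q₁ s) (β s))‖ ≤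
        (‖B‖ * m) * N + m * N := by
      calc _ ≤ ∫ s in τ..T, ((‖B‖ * m) * ‖α s‖ + m * ‖β s‖) := by
            refine intervalIntegral.norm_integral_le_of_norm_le hτ.2
              (Filter.Eventually.of_forall fun s hs => hbd s ⟨hτ.1.trans hs.1.le, hs.2⟩ _ _)
              (hgc.intervalIntegrable _ _)
        _ ≤ ∫ s in (0 : ℝ)..T, ((‖B‖ * m) * ‖α s‖ + m * ‖β s‖) :=
            intervalIntegral.integral_mono_interval hτ.1 hτ.2 le_rfl
              (Filter.Eventually.of_forall fun s => by
                show (0 : ℝ) ≤ _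
                positivity) (hgc.intervalIntegrable _ _)
        _ = (‖B‖ * m) * (∫ s in (0 : ℝ)..T, ‖α s‖) + m * ∫ s in (0 : ℝ)..T, ‖β s‖ := by
            rw [intervalIntegral.integral_add ((hαc.norm.const_mul _).intervalIntegrable _ _)
              ((hβc.norm.const_mul _).intervalIntegrable _ _),
              intervalIntegral.integral_const_mul, intervalIntegral.integral_const_mul]
        _ ≤ _ := by
            refine add_le_add ?_ ?_
            · exact mul_le_mul_of_nonneg_left (le_add_of_nonneg_right hNβ) (by positivity)
            · exact mul_le_mul_of_nonneg_left (le_add_of_nonneg_left hNα) hm0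
    have h3 := (abs_le.1 (Real.norm_eq_abs _ ▸ h2)).1
    linarith
  have hlower : d * m ^ 2 / 4 ≤ (B (P₁ τ) (P₁ τ) + inner ℝ (Q₁ τ) (Q₁ τ)) / 2 := by
    have h1 := hcoer (P₁ τ)
    have h2 : d * ‖P₁ τ‖ ^ 2 ≤ c * ‖P₁ τ‖ * ‖P₁ τ‖ := by
      rw [mul_assoc, ← sq]
      exact mul_le_mul_of_nonneg_right (min_le_left _ _) (sq_nonneg _)
    have h3 : d * ‖Q₁ τ‖ ^ 2 ≤ 1 * ‖Q₁ τ‖ ^ 2 :=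
      mul_le_mul_of_nonneg_right (min_le_right _ _) (sq_nonneg _)
    rw [real_inner_self_eq_norm_sq]
    have h4 : m ^ 2 ≤ 2 * (‖P₁ τ‖ ^ 2 + ‖Q₁ τ‖ ^ 2) := by
      rw [hm]
      nlinarith [sq_nonneg (‖P₁ τ‖ - ‖Q₁ τ‖)]
    have h5 := mul_le_mul_of_nonneg_left h4 hd0.le
    linarith
  have hmN : m ≤ K₀ * N := by
    rcases hm0.eq_or_lt with h0 | hpos
    · rw [← h0]
      positivity
    · have h1 := hlower.trans hupper
      have h2 : d * m ≤ 8 * (‖B‖ + 1) * N := by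
        by_contra! hlt
        have := mul_lt_mul_of_pos_right hlt hpos
        nlinarith
      rw [hK₀, div_mul_eq_mul_div, le_div_iff₀ hd0]
      linarith
  intro t ht
  -- The extra `1` in the constant `K₀ + 1` pays for `α₁` and `β₁`.
  constructor
  · have e : S (Q t) = α₁ t - P₁ t := (add_sub_cancel_left _ _).symm
    rw [e]
    have := norm_sub_le (α₁ t) (P₁ t)
    linarith [hα₁N t ht, hPm t ht]
  · have e : j (P t) = β₁ t + Q₁ t := (sub_add_cancel _ _).symm
    rw [e]
    have := norm_add_le (β₁ t) (Q₁ t)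
    linarith [hβ₁N t ht, hQm t ht]

end Abstract

/-! ### Existence by duality. -/

section Existence

variable {V H : Type*} [NormedAddCommGroup V] [InnerProductSpace ℝ V] [CompleteSpace V]
  [NormedAddCommGroup H] [InnerProductSpace ℝ H] [CompleteSpace H]
  {j : V →L[ℝ] H} {B : V →L[ℝ] V →L[ℝ] ℝ} {T : ℝ}

/-- Post-composition with a continuous linear map. -/
def postcomp {X Y : Type*} [NormedAddCommGroup X] [NormedSpace ℝ X] [NormedAddCommGroup Y]
    [NormedSpace ℝ Y] (A : X →L[ℝ] Y) : C(ℝ, X) →ₗ[ℝ] C(ℝ, Y) where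
  toFun φ := ⟨fun t => A (φ t), A.continuous.comp φ.continuous⟩
  map_add' φ ψ := by ext t; exact map_add A _ _
  map_smul' c φ := by ext t; exact map_smul A _ _

lemma integrable_of_L2 {X : Type*} [NormedAddCommGroup X] (u : L2 0 T X) :
    Integrable u (volume.restrict (Ioo 0 T)) :=
  (Lp.memLp u).integrable one_le_two

lemma inner_contToL2 {X : Type*} [NormedAddCommGroup X] [InnerProductSpace ℝ X] [CompleteSpace X]
    (u : L2 0 T X) (φ : C(ℝ, X)) :
    inner ℝ u (contToL2 X T φ) = ∫ t in Ioo 0 T, inner ℝ (u t) (φ t) := by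
  rw [L2.inner_def]
  refine integral_congr_ae ?_
  filter_upwards [coeFn_contToL2 φ T] with t ht
  rw [ht]

/-- Existence of variational solutions. -/
lemma exists_variational_solution (hB : IsCoercive B) (hsymm : ∀ x y, B x y = B y x) (hT : 0 < T)
    (g : V) (h : H) (f : L2 0 T H) :
    ∃ (S : H →L[ℝ] V) (u : L2 0 T V) (v : L2 0 T H), (∀ y x, B (S y) x = inner ℝ y (j x)) ∧
      ∀ (ζ : C(ℝ, V)) (ξ : C(ℝ, H)),
      (∫ t in Ioo 0 T, B (u t) (tail V T ζ t + S (ξ t))) +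
          ∫ t in Ioo 0 T, inner ℝ (v t) (j (ζ t) - tail H T ξ t) =
        inner ℝ (j g) (tail H T ξ 0) + inner ℝ h (j (tail V T ζ 0)) +
          ∫ t in Ioo 0 T, inner ℝ (f t) (j (tail V T ζ t)) := by
  -- The Lax-Milgram isomorphism of `B`. It turns `B (u t)` into an inner product, as Riesz
  -- requires, and `S = A⁻¹ j*`.
  set A : V ≃L[ℝ] V := hB.continuousLinearEquivOfBilin with hA
  have hAB : ∀ x y, inner ℝ (A x) y = B x y := fun x y =>
    hB.continuousLinearEquivOfBilin_apply x y
  set S : H →L[ℝ] V := A.symm.toContinuousLinearMap.comp (ContinuousLinearMap.adjoint j) with hS'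
  have hS : ∀ y x, B (S y) x = inner ℝ y (j x) := fun y x => by
    rw [← hAB, ← ContinuousLinearMap.adjoint_inner_left]
    simp [hS']
  obtain ⟨K, hK0, hK⟩ := exists_energy_estimate hB hsymm hS hT
  obtain ⟨K₁, hK₁0, hK₁⟩ := exists_integral_norm_le_contToL2 V hT
  obtain ⟨K₂, hK₂0, hK₂⟩ := exists_integral_norm_le_contToL2 H hT
  obtain ⟨K₃, hK₃0, hK₃⟩ := exists_norm_contToL2_le H T
  let R₁' : C(ℝ, V) × C(ℝ, H) →ₗ[ℝ] C(ℝ, V) :=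
    (tail V T).comp (LinearMap.fst ℝ _ _) + (postcomp S).comp (LinearMap.snd ℝ _ _)
  let R₁ : C(ℝ, V) × C(ℝ, H) →ₗ[ℝ] C(ℝ, V) := (postcomp A.toContinuousLinearMap).comp R₁'
  let R₂ : C(ℝ, V) × C(ℝ, H) →ₗ[ℝ] C(ℝ, H) :=
    (postcomp j).comp (LinearMap.fst ℝ _ _) - (tail H T).comp (LinearMap.snd ℝ _ _)
  let R : C(ℝ, V) × C(ℝ, H) →ₗ[ℝ] WithLp 2 (L2 0 T V × L2 0 T H) :=
    (WithLp.linearEquiv 2 ℝ (L2 0 T V × L2 0 T H)).symm.toLinearMap.comp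
      (((contToL2 V T).comp R₁).prod ((contToL2 H T).comp R₂))
  let jP : C(ℝ, V) × C(ℝ, H) →ₗ[ℝ] C(ℝ, H) :=
    (postcomp j).comp ((tail V T).comp (LinearMap.fst ℝ _ _))
  let Q : C(ℝ, V) × C(ℝ, H) →ₗ[ℝ] C(ℝ, H) := (tail H T).comp (LinearMap.snd ℝ _ _)
  let ev : C(ℝ, H) →ₗ[ℝ] H := (ContinuousMap.evalCLM ℝ (0 : ℝ)).toLinearMap
  let ℓ : C(ℝ, V) × C(ℝ, H) →ₗ[ℝ] ℝ :=
    (innerSL ℝ (j g)).toLinearMap.comp (ev.comp Q) + (innerSL ℝ h).toLinearMap.comp (ev.comp jP) +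
      (innerSL ℝ f).toLinearMap.comp ((contToL2 H T).comp jP)
  have hℓ : ∀ p, ℓ p = inner ℝ (j g) (Q p 0) + inner ℝ h (jP p 0) +
    inner ℝ f (contToL2 H T (jP p)) := fun p => rfl
  have hR₁ : ∀ p, (R p).fst = contToL2 V T (R₁ p) := fun p => rfl
  have hR₂ : ∀ p, (R p).snd = contToL2 H T (R₂ p) := fun p => rfl
  have h0mem : (0 : ℝ) ∈ Icc 0 T := left_mem_Icc.2 hT.le
  set KA := ‖A.symm.toContinuousLinearMap‖ with hKA
  have hest : ∀ p, |ℓ p| ≤ ((‖B‖ * ‖g‖ + ‖h‖ + ‖f‖ * K₃) * (K * (K₁ * KA + K₂))) * ‖R p‖ := by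
    intro p
    have hKp := hK (tail V T (tail V T p.1)) (tail V T p.1) p.1 (tail H T (tail H T p.2))
      (tail H T p.2) p.2 (hasDerivAt_tail (tail V T p.1).continuous T)
      (hasDerivAt_tail p.1.continuous T) p.1.continuous
      (hasDerivAt_tail (tail H T p.2).continuous T) (hasDerivAt_tail p.2.continuous T)
      p.2.continuous intervalIntegral.integral_same intervalIntegral.integral_same
      intervalIntegral.integral_same intervalIntegral.integral_same
    set N := (∫ s in (0 : ℝ)..T, ‖tail V T p.1 s + S (p.2 s)‖) +
      ∫ s in (0 : ℝ)..T, ‖j (p.1 s) - tail H T p.2 s‖ with hN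
    have hN0 : 0 ≤ N := add_nonneg
      (intervalIntegral.integral_nonneg hT.le fun s _ => norm_nonneg _)
      (intervalIntegral.integral_nonneg hT.le fun s _ => norm_nonneg _)
    -- The first component of `R p` carries an `A`, which is undone at the cost of `KA = ‖A⁻¹‖`.
    have hNR : N ≤ (K₁ * KA + K₂) * ‖R p‖ := by
      have h1 : ∫ s in (0 : ℝ)..T, ‖tail V T p.1 s + S (p.2 s)‖ ≤
          ∫ s in (0 : ℝ)..T, KA * ‖R₁ p s‖ := by
        refine intervalIntegral.integral_mono_on hT.le
          ((R₁' p).continuous.norm.intervalIntegrable _ _)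
          (((R₁ p).continuous.norm.const_mul KA).intervalIntegrable _ _) fun s _ => ?_
        have e : tail V T p.1 s + S (p.2 s) = A.symm (R₁ p s) := (A.symm_apply_apply _).symm
        rw [e]
        exact A.symm.toContinuousLinearMap.le_opNorm _
      rw [intervalIntegral.integral_const_mul] at h1
      have h2 := hK₁ (R₁ p)
      have h3 : ∫ s in (0 : ℝ)..T, ‖j (p.1 s) - tail H T p.2 s‖ ≤ K₂ * ‖contToL2 H T (R₂ p)‖ :=
        hK₂ (R₂ p)
      have h4 : ‖contToL2 V T (R₁ p)‖ ≤ ‖R p‖ := WithLp.norm_fst_le (L2 0 T V) (R p)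
      have h5 : ‖contToL2 H T (R₂ p)‖ ≤ ‖R p‖ := WithLp.norm_snd_le (L2 0 T V) (R p)
      have hKA0 : 0 ≤ KA := norm_nonneg _
      calc N ≤ KA * (K₁ * ‖R p‖) + K₂ * ‖R p‖ := by
            refine add_le_add (h1.trans (mul_le_mul_of_nonneg_left (h2.trans ?_) hKA0))
              (h3.trans (mul_le_mul_of_nonneg_left h5 hK₂0))
            exact mul_le_mul_of_nonneg_left h4 hK₁0
        _ = _ := by ring
    have hM : K * N ≤ K * (K₁ * KA + K₂) * ‖R p‖ := by
      rw [mul_assoc]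
      exact mul_le_mul_of_nonneg_left hNR hK0
    have hM0 : 0 ≤ K * N := mul_nonneg hK0 hN0
    -- `Q` itself is not bounded by `N`, only `S Q` is; because `g` lies in `V`, the pairing can be
    -- rewritten as `B (S (Q p 0)) g`.
    have b1 : |inner ℝ (j g) (Q p 0)| ≤ ‖B‖ * ‖g‖ * (K * N) := by
      rw [real_inner_comm, ← hS, hsymm]
      exact (B.le_opNorm₂ _ _).trans (mul_le_mul_of_nonneg_left (hKp 0 h0mem).1
        (mul_nonneg B.opNorm_nonneg (norm_nonneg _)))
    have b2 : |inner ℝ h (jP p 0)| ≤ ‖h‖ * (K * N) :=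
      (abs_real_inner_le_norm _ _).trans
        (mul_le_mul_of_nonneg_left (hKp 0 h0mem).2 (norm_nonneg _))
    have b3 : |inner ℝ f (contToL2 H T (jP p))| ≤ ‖f‖ * (K₃ * (K * N)) :=
      (abs_real_inner_le_norm _ _).trans (mul_le_mul_of_nonneg_left
        (hK₃ (jP p) _ hM0 fun t ht => (hKp t ht).2) (norm_nonneg _))
    rw [hℓ]
    calc _ ≤ ‖B‖ * ‖g‖ * (K * N) + ‖h‖ * (K * N) + ‖f‖ * (K₃ * (K * N)) :=
          (abs_add_three _ _ _).trans (add_le_add (add_le_add b1 b2) b3)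
      _ = (‖B‖ * ‖g‖ + ‖h‖ + ‖f‖ * K₃) * (K * N) := by ring
      _ ≤ (‖B‖ * ‖g‖ + ‖h‖ + ‖f‖ * K₃) * (K * (K₁ * KA + K₂) * ‖R p‖) := by
          refine mul_le_mul_of_nonneg_left hM ?_
          have := B.opNorm_nonneg
          positivity
      _ = _ := by ring
  obtain ⟨x, hx⟩ := exists_forall_inner_eq R ℓ _ hest
  refine ⟨S, x.fst, x.snd, hS, fun ζ ξ => ?_⟩
  have key := hx (ζ, ξ)
  rw [WithLp.prod_inner_apply] at key
  change inner ℝ x.fst (R (ζ, ξ)).fst + inner ℝ x.snd (R (ζ, ξ)).snd = _ at key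
  rw [hℓ, hR₁, hR₂, inner_contToL2, inner_contToL2, inner_contToL2] at key
  refine Eq.trans ?_ key
  congr 1
  refine integral_congr_ae (Filter.Eventually.of_forall fun t => ?_)
  change B (x.fst t) (tail V T ζ t + S (ξ t)) =
    inner ℝ (x.fst t) (A (tail V T ζ t + S (ξ t)))
  rw [hsymm, ← hAB, real_inner_comm]

/-- Existence for `j u'' + B u = j* f`, `u(0) = g`, `u'(0) = h`, in integrated form. -/
theorem exists_isPrimitive (hB : IsCoercive B) (hsymm : ∀ x y, B x y = B y x) (hT : 0 < T)
    (g : V) (h : H) (f : L2 0 T H) :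
    ∃ (u : L2 0 T V) (v : L2 0 T H), IsPrimitive T (fun t => j (u t)) v (j g) ∧
      IsPrimitive T (fun t => (innerSL ℝ (v t)).comp j)
        (fun t => (innerSL ℝ (f t)).comp j - B (u t)) ((innerSL ℝ h).comp j) := by
  obtain ⟨S, u, v, hS, huv⟩ := exists_variational_solution (j := j) hB hsymm hT g h f
  have hui := integrable_of_L2 u
  have hvi := integrable_of_L2 v
  have hfi := integrable_of_L2 f
  have hju : Integrable (fun t => j (u t)) (volume.restrict (Ioo 0 T)) := j.integrable_comp hui
  let D : H →L[ℝ] V →L[ℝ] ℝ := (ContinuousLinearMap.precomp ℝ j).comp (innerSL ℝ)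
  have hDv : Integrable (fun t => D (v t)) (volume.restrict (Ioo 0 T)) := D.integrable_comp hvi
  have hDf : Integrable (fun t => D (f t) - B (u t)) (volume.restrict (Ioo 0 T)) :=
    (D.integrable_comp hfi).sub (B.integrable_comp hui)
  have hint : ∀ φ : ℝ → ℝ, ∫ t in (0 : ℝ)..T, φ t = ∫ t in Ioo 0 T, φ t := fun φ => by
    rw [intervalIntegral.integral_of_le hT.le, integral_Ioc_eq_integral_Ioo]
  refine ⟨u, v, isPrimitive_of_forall_test hju hvi fun φ => ?_,
    isPrimitive_of_forall_test hDv hDf fun φ => ?_⟩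
  · have hΦ : Continuous fun t => ∫ s in t..T, φ s :=
      (tail ℝ T ⟨φ, φ.continuous⟩).continuous
    refine ext_inner_left ℝ fun y => ?_
    -- With `ζ = 0` and `ξ = φ y`, only the identity `j u = j g + ∫ v`, tested against `φ` and `y`,
    -- remains.
    have key := huv 0 ⟨fun t => φ t • y, φ.continuous.smul continuous_const⟩
    have e1 : ∀ t, tail H T ⟨fun t => φ t • y, φ.continuous.smul continuous_const⟩ t =
      (∫ s in t..T, φ s) • y := fun t => intervalIntegral.integral_smul_const _ _
    simp only [map_zero, ContinuousMap.zero_apply, zero_add, zero_sub, e1, ContinuousMap.coe_mk,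
      map_smul, inner_zero_right, integral_zero, add_zero, inner_neg_right, integral_neg] at key
    simp only [hsymm _ (S y), hS, smul_eq_mul, inner_smul_right, hint] at key
    rw [inner_add_right, inner_smul_right,
      ← integral_inner (integrable_smul_of_continuous φ.continuous hju),
      ← integral_inner (integrable_smul_of_continuous hΦ hvi)]
    simp only [inner_smul_right]
    rw [real_inner_comm y (j g)] at key
    simp only [fun t => real_inner_comm y (v t)] at key
    linarith
  · have hΦ : Continuous fun t => ∫ s in t..T, φ s :=
      (tail ℝ T ⟨φ, φ.continuous⟩).continuous
    ext x
    -- With `ξ = 0` and `ζ = φ x`, only the identity for `(v, j x)` remains.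
    have key := huv ⟨fun t => φ t • x, φ.continuous.smul continuous_const⟩ 0
    have e1 : ∀ t, tail V T ⟨fun t => φ t • x, φ.continuous.smul continuous_const⟩ t =
      (∫ s in t..T, φ s) • x := fun t => intervalIntegral.integral_smul_const _ _
    simp only [map_zero, ContinuousMap.zero_apply, add_zero, sub_zero, e1, ContinuousMap.coe_mk,
      map_smul, inner_zero_right, zero_add] at key
    simp only [smul_eq_mul, inner_smul_right, hint] at key
    change (∫ t in Ioo 0 T, φ t • D (v t)) x = ((∫ t in Ioo 0 T, φ t) • D h +
      ∫ t in Ioo 0 T, (∫ s in t..T, φ s) • (D (f t) - B (u t))) x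
    rw [ContinuousLinearMap.integral_apply (integrable_smul_of_continuous φ.continuous hDv),
      add_apply, ContinuousLinearMap.integral_apply (integrable_smul_of_continuous hΦ hDf)]
    have e2 : ∀ t, ((∫ s in t..T, φ s) • (D (f t) - B (u t))) x =
      (∫ s in t..T, φ s) * inner ℝ (f t) (j x) - (∫ s in t..T, φ s) * B (u t) x := fun t =>
        mul_sub _ _ _
    have e3 : ∀ t, (φ t • D (v t)) x = φ t * inner ℝ (v t) (j x) := fun t => rfl
    have e4 : ((∫ t in Ioo 0 T, φ t) • D h) x =
      (∫ t in Ioo 0 T, φ t) * inner ℝ h (j x) := rfl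
    refine (congrArg₂ (· = ·) ?_ ?_).mpr (eq_sub_of_add_eq' key)
    · simp only [e3]
    · simp only [e2, e4]
      rw [integral_sub (f := fun t => (∫ s in t..T, φ s) * inner ℝ (f t) (j x))
        (g := fun t => (∫ s in t..T, φ s) * B (u t) x)
        (integrable_smul_of_continuous hΦ (hfi.inner_const (j x)))
        (integrable_smul_of_continuous hΦ (((B.flip x)).integrable_comp hui))]
      ring

end Existence

/-! ### Uniqueness by the energy of the twice integrated equation. -/

lemma eq_zero_of_isCoercive {V : Type*} [NormedAddCommGroup V] [InnerProductSpace ℝ V]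
    {B : V →L[ℝ] V →L[ℝ] ℝ} (hB : IsCoercive B) {x : V} (h : B x x ≤ 0) : x = 0 := by
  obtain ⟨c, hc, hcoer⟩ := hB
  have h1 := (hcoer x).trans h
  by_contra hx
  have := norm_pos_iff.2 hx
  have : 0 < c * ‖x‖ * ‖x‖ := by positivity
  linarith

section Uniqueness

variable {V H : Type*} [NormedAddCommGroup V] [InnerProductSpace ℝ V] [CompleteSpace V]
  [NormedAddCommGroup H] [InnerProductSpace ℝ H] [CompleteSpace H]
  {j : V →L[ℝ] H} {B : V →L[ℝ] V →L[ℝ] ℝ} {T : ℝ}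

lemma integral_primitive_congr {X : Type*} [NormedAddCommGroup X] [NormedSpace ℝ X] {p q : ℝ → X}
    (hpq : ∀ᵐ t ∂volume.restrict (Ioo 0 T), p t = q t) (t : ℝ) (ht : t ∈ Icc 0 T) :
    ∫ s in (0 : ℝ)..t, p s = ∫ s in (0 : ℝ)..t, q s := by
  rw [intervalIntegral.integral_of_le ht.1, intervalIntegral.integral_of_le ht.1,
    integral_Ioc_eq_integral_Ioo, integral_Ioc_eq_integral_Ioo]
  exact integral_congr_ae (ae_restrict_of_ae_restrict_of_subset (Ioo_subset_Ioo_right ht.2) hpq)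

lemma hasDerivAt_primitive {X : Type*} [NormedAddCommGroup X] [NormedSpace ℝ X] [CompleteSpace X]
    {p : ℝ → X} (hp : Continuous p) (t : ℝ) :
    HasDerivAt (fun t => ∫ s in (0 : ℝ)..t, p s) (p t) t :=
  intervalIntegral.integral_hasDerivAt_right (hp.intervalIntegrable _ _)
    hp.stronglyMeasurable.stronglyMeasurableAtFilter hp.continuousAt

/-- Uniqueness for `j u'' + B u = 0`, `u(0) = 0`, `u'(0) = 0`, in integrated form. -/
theorem ae_eq_zero_of_isPrimitive (hB : IsCoercive B) (hsymm : ∀ x y, B x y = B y x)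
    {u : ℝ → V} {v : ℝ → H} (hu : Integrable u (volume.restrict (Ioo 0 T)))
    (hju : IsPrimitive T (fun t => j (u t)) v 0)
    (hjv : ∀ x, IsPrimitive T (fun t => (inner ℝ (v t) (j x) : ℝ)) (fun t => -B (u t) x) 0) :
    u =ᵐ[volume.restrict (Ioo 0 T)] 0 := by
  have hv := hju.integrable_deriv
  -- Extending by zero outside `(0, T)` makes `z` and `w` continuous on the whole line, so that `Z`
  -- and `W` are differentiable everywhere.
  set z : ℝ → H := fun t => ∫ s in (0 : ℝ)..t, (Ioo 0 T).indicator v s with hz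
  set w : ℝ → V := fun t => ∫ s in (0 : ℝ)..t, (Ioo 0 T).indicator u s with hw
  have hzc : Continuous z := intervalIntegral.continuous_primitive
    (fun _ _ => ((integrable_indicator_iff measurableSet_Ioo).2 hv).intervalIntegrable) 0
  have hwc : Continuous w := intervalIntegral.continuous_primitive
    (fun _ _ => ((integrable_indicator_iff measurableSet_Ioo).2 hu).intervalIntegrable) 0
  have hz' : ∀ t ∈ Icc 0 T, z t = ∫ s in (0 : ℝ)..t, v s := integral_primitive_congr <| by
    filter_upwards [ae_restrict_mem measurableSet_Ioo] with t ht using indicator_of_mem ht v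
  have hw' : ∀ t ∈ Icc 0 T, w t = ∫ s in (0 : ℝ)..t, u s := integral_primitive_congr <| by
    filter_upwards [ae_restrict_mem measurableSet_Ioo] with t ht using indicator_of_mem ht u
  set Z : ℝ → H := fun t => ∫ s in (0 : ℝ)..t, z s with hZ
  set W : ℝ → V := fun t => ∫ s in (0 : ℝ)..t, w s with hW
  have hZd : ∀ t, HasDerivAt Z (z t) t := hasDerivAt_primitive hzc
  have hWd : ∀ t, HasDerivAt W (w t) t := hasDerivAt_primitive hwc
  have h0 : ∀ t ∈ Icc 0 T, (0 : ℝ) ∈ Icc 0 T := fun t ht => ⟨le_rfl, ht.1.trans ht.2⟩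
  have hjw : ∀ t ∈ Icc 0 T, j (w t) = Z t := by
    intro t ht
    rw [hw' t ht, ← j.intervalIntegral_comp_comm
      (intervalIntegrable_of_integrable_restrict hu (h0 t ht) ht)]
    refine integral_primitive_congr ?_ t ht
    filter_upwards [hju.ae_eq, ae_restrict_mem measurableSet_Ioo] with s hs hsT
    rw [hs, zero_add, hz' s (Ioo_subset_Icc_self hsT)]
  have hjz : ∀ t ∈ Icc 0 T, ∀ x, inner ℝ (z t) (j x) = -B (W t) x := by
    intro t ht x
    have e1 : inner ℝ (z t) (j x) = ∫ s in (0 : ℝ)..t, (inner ℝ (v s) (j x) : ℝ) := by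
      rw [hz' t ht, real_inner_comm]
      have h := (innerSL ℝ (j x)).intervalIntegral_comp_comm
        (intervalIntegrable_of_integrable_restrict hv (h0 t ht) ht)
      simp only [innerSL_apply_apply] at h
      rw [← h]
      simp only [real_inner_comm]
    have e2 : B (W t) x = ∫ s in (0 : ℝ)..t, B (w s) x :=
      ((B.flip x).intervalIntegral_comp_comm (hwc.intervalIntegrable (μ := volume) 0 t)).symm
    rw [e1, e2, ← intervalIntegral.integral_neg]
    refine integral_primitive_congr ?_ t ht
    filter_upwards [(hjv x).ae_eq, ae_restrict_mem measurableSet_Ioo] with s hs hsT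
    have hsI := Ioo_subset_Icc_self hsT
    rw [hs, zero_add, intervalIntegral.integral_neg, hw' s hsI]
    congr 1
    exact (B.flip x).intervalIntegral_comp_comm
      (intervalIntegrable_of_integrable_restrict hu (h0 s hsI) hsI)
  have hE : ∀ t, HasDerivAt (fun t => inner ℝ (Z t) (Z t) + B (W t) (W t))
      (2 * (inner ℝ (z t) (Z t) + B (w t) (W t))) t := by
    intro t
    have h1 := (hZd t).inner ℝ (hZd t)
    have h2 := B.hasDerivAt_of_bilinear (fun _ => hWd t) (fun _ => hWd t)
    refine (h1.add h2).congr_deriv ?_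
    rw [hsymm (W t) (w t), real_inner_comm (z t) (Z t)]
    ring
  -- Testing `(z, j x) = -B W x` with `x = w`, where `j w = Z`, makes the derivative vanish.
  have hE0 : ∀ t ∈ Icc 0 T, inner ℝ (Z t) (Z t) + B (W t) (W t) = 0 := by
    have h := constant_of_has_deriv_right_zero (a := 0) (b := T)
      (fun t _ => (hE t).continuousAt.continuousWithinAt) fun t ht => by
        have htI : t ∈ Icc 0 T := ⟨ht.1, ht.2.le⟩
        have h1 := (hE t).hasDerivWithinAt (s := Ici t)
        rwa [← hjw t htI, hjz t htI, hsymm (W t) (w t), neg_add_cancel, mul_zero] at h1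
    intro t ht
    rw [h t ht]
    simp [hZ, hW]
  have hW0 : ∀ t ∈ Icc 0 T, W t = 0 := fun t ht => eq_zero_of_isCoercive hB (by
    have := hE0 t ht
    have h2 : (0 : ℝ) ≤ inner ℝ (Z t) (Z t) := real_inner_self_nonneg
    linarith)
  have hw0 : ∀ t ∈ Ioo 0 T, w t = 0 := fun t ht => by
    have h1 : W =ᶠ[nhds t] fun _ => 0 := by
      filter_upwards [isOpen_Ioo.mem_nhds ht] with s hs using hW0 s (Ioo_subset_Icc_self hs)
    exact ((hWd t).congr_of_eventuallyEq h1.symm).unique (hasDerivAt_const t 0)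
  refine ae_eq_zero_of_forall_test hu fun φ => ?_
  -- Fubini against `φ'` expresses `∫ φ u` through the primitive `w`, which is zero.
  have h1 := integral_smul_primitive φ.contDiff_deriv.continuous hu
  simp only [φ.integral_deriv_right, neg_smul] at h1
  rw [integral_neg, eq_neg_iff_add_eq_zero] at h1
  rw [← h1, right_eq_add]
  refine setIntegral_eq_zero_of_forall_eq_zero fun t ht => ?_
  rw [← hw' t (Ioo_subset_Icc_self ht), hw0 t ht, smul_zero]

end Uniqueness

/-! ### The form `E` on its domain -/

/-- Against a fixed test function both integrals are `L²` inner products, hence continuous. `H¹` is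
therefore closed in `L² × L²`, and so complete. -/
lemma mem_H1_iff {a b : ℝ} (p : WithLp 2 (L2 a b ℝ × L2 a b ℝ)) :
    p ∈ H1 a b ↔ ∀ φ : Test a b, inner ℝ ((φ.memLp_deriv 2 _).toLp (deriv φ) : L2 a b ℝ) p.fst +
      inner ℝ ((φ.memLp 2 _).toLp φ : L2 a b ℝ) p.snd = 0 := by
  have h1 : ∀ φ : Test a b, inner ℝ ((φ.memLp_deriv 2 _).toLp (deriv φ) : L2 a b ℝ) p.fst =
      ∫ t in Ioo a b, deriv φ t • p.fst t := fun φ => by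
    rw [L2.inner_def]
    refine integral_congr_ae ?_
    filter_upwards [MemLp.coeFn_toLp (φ.memLp_deriv 2 (volume.restrict (Ioo a b)))] with t ht
    rw [ht]
    exact mul_comm _ _
  have h2 : ∀ φ : Test a b, inner ℝ ((φ.memLp 2 _).toLp φ : L2 a b ℝ) p.snd =
      ∫ t in Ioo a b, φ t • p.snd t := fun φ => by
    rw [L2.inner_def]
    refine integral_congr_ae ?_
    filter_upwards [MemLp.coeFn_toLp (φ.memLp 2 (volume.restrict (Ioo a b)))] with t ht
    rw [ht]
    exact mul_comm _ _
  simp only [h1, h2, add_eq_zero_iff_eq_neg]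
  exact ⟨fun h => h.integral_eq, fun h => ⟨(Lp.memLp p.fst).integrable one_le_two,
    (Lp.memLp p.snd).integrable one_le_two, h⟩⟩

instance completeSpace_H1 (a b : ℝ) : CompleteSpace (H1 a b) := by
  suffices h : IsClosed (H1 a b : Set (WithLp 2 (L2 a b ℝ × L2 a b ℝ))) from h.completeSpace_coe
  have : (H1 a b : Set (WithLp 2 (L2 a b ℝ × L2 a b ℝ))) = ⋂ φ : Test a b,
      {p | inner ℝ ((φ.memLp_deriv 2 _).toLp (deriv φ) : L2 a b ℝ) p.fst +
      inner ℝ ((φ.memLp 2 _).toLp φ : L2 a b ℝ) p.snd = 0} := by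
    ext p
    simp only [SetLike.mem_coe, mem_H1_iff, mem_iInter, mem_ofPred_eq]
  rw [this]
  refine isClosed_iInter fun φ => isClosed_eq ?_ continuous_const
  exact (continuous_const.inner (WithLp.prod_continuous_ofLp 2 _ _).fst).add
    (continuous_const.inner (WithLp.prod_continuous_ofLp 2 _ _).snd)

instance completeSpace_H01 (a b : ℝ) : CompleteSpace (H01 a b) :=
  (Submodule.isClosed_topologicalClosure (LinearMap.range (testToH1 a b))).completeSpace_coe

/-- The weak derivative as a bounded linear map. -/
def weakDerivL (a b : ℝ) : H01 a b →L[ℝ] L2 a b ℝ :=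
  (WithLp.sndL 2 ℝ (L2 a b ℝ) (L2 a b ℝ)).comp ((H1 a b).subtypeL.comp (H01.toH1 a b))

lemma weakDerivL_apply {a b : ℝ} (u : H01 a b) : weakDerivL a b u = weakDeriv u := rfl

instance completeSpace_DomE (μ : Measure ℝ) [IsFiniteMeasure μ] (a b : ℝ) :
    CompleteSpace (DomE μ a b) := by
  suffices h : IsClosed (DomE μ a b : Set (H01 a b)) from h.completeSpace_coe
  have : (DomE μ a b : Set (H01 a b)) = ⋂ v : H01 a b, ⋂ _ : ‖iota μ a b v‖ = 0,
      {u | inner ℝ (weakDerivL a b v) (weakDerivL a b u) = 0} := by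
    ext u
    simp only [mem_iInter, mem_ofPred_eq, weakDerivL_apply, ← energy_eq_inner]
    rfl
  rw [this]
  exact isClosed_iInter fun v => isClosed_iInter fun _ =>
    isClosed_eq (continuous_const.inner (weakDerivL a b).continuous) continuous_const

lemma Test.integral_abs_deriv_le (a b : ℝ) : ∃ K, 0 ≤ K ∧ ∀ φ : Test a b,
    ∫ t in Ioo a b, |deriv φ t| ≤ K * ‖weakDeriv (testToH01 a b φ)‖ := by
  set ν := volume.restrict (Ioo a b) with hν
  refine ⟨((ν univ) ^ (1 / (1 : ℝ≥0∞).toReal - 1 / (2 : ℝ≥0∞).toReal)).toReal,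
    ENNReal.toReal_nonneg, fun φ => ?_⟩
  have hd := φ.memLp_deriv 2 ν
  have e1 : ∫ t in Ioo a b, |deriv φ t| = (eLpNorm (deriv φ) 1 ν).toReal := by
    rw [eLpNorm_one_eq_lintegral_enorm, ← integral_norm_eq_lintegral_enorm hd.1]
    rfl
  have e2 : ‖weakDeriv (testToH01 a b φ)‖ = (eLpNorm (deriv φ) 2 ν).toReal := Lp.norm_toLp _ hd
  rw [e1, e2, mul_comm, ← ENNReal.toReal_mul]
  refine ENNReal.toReal_mono (ENNReal.mul_ne_top hd.2.ne ?_)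
    (eLpNorm_le_eLpNorm_mul_rpow_measure_univ (by norm_num) hd.1)
  exact ENNReal.rpow_ne_top_of_nonneg (by norm_num) (measure_ne_top _ _)

/-- The Poincaré inequality on `H₀¹(a,b)`. -/
lemma exists_poincare (a b : ℝ) :
    ∃ C, 0 < C ∧ ∀ u : H01 a b, ‖u‖ ^ 2 ≤ C * ‖weakDeriv u‖ ^ 2 := by
  obtain ⟨K, hK0, hK⟩ := Test.integral_abs_deriv_le a b
  set M : ℝ := (measureUnivNNReal (volume.restrict (Ioo a b)) : ℝ) ^ (2 : ℝ≥0∞).toReal⁻¹ with hM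
  -- On test functions `(M * K) ^ 2` comes from `|φ| ≤ ∫ |φ'|` and Hölder's inequality, and the `1`
  -- is the derivative's own share of the `H¹` norm; density does the rest.
  refine ⟨(M * K) ^ 2 + 1, by positivity, fun u => ?_⟩
  refine (denseRange_testToH01 a b).induction_on (p := fun u =>
    ‖u‖ ^ 2 ≤ ((M * K) ^ 2 + 1) * ‖weakDeriv u‖ ^ 2) u ?_ fun φ => ?_
  · exact isClosed_le (by fun_prop)
      (continuous_const.mul ((weakDerivL a b).continuous.norm.pow 2))
  · have h1 : ‖testToH01 a b φ‖ ^ 2 =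
        ‖(φ.memLp 2 (volume.restrict (Ioo a b))).toLp φ‖ ^ 2 +
          ‖weakDeriv (testToH01 a b φ)‖ ^ 2 :=
      WithLp.prod_norm_sq_eq_of_L2 (testToH1 a b φ).1
    have h2 : ‖(φ.memLp 2 (volume.restrict (Ioo a b))).toLp φ‖ ≤
        M * (K * ‖weakDeriv (testToH01 a b φ)‖) := by
      refine Lp.norm_le_of_ae_bound (by positivity) ?_
      filter_upwards [MemLp.coeFn_toLp (φ.memLp 2 (volume.restrict (Ioo a b)))] with x hx
      rw [hx, Real.norm_eq_abs]
      exact (φ.abs_le x).trans (hK φ)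
    have h3 := pow_le_pow_left₀ (norm_nonneg _) h2 2
    rw [h1]
    calc _ ≤ (M * (K * ‖weakDeriv (testToH01 a b φ)‖)) ^ 2 +
          ‖weakDeriv (testToH01 a b φ)‖ ^ 2 := by gcongr
      _ = _ := by ring

/-- The form `E` as a bounded bilinear form on its domain. -/
def energyL (μ : Measure ℝ) [IsFiniteMeasure μ] (a b : ℝ) :
    DomE μ a b →L[ℝ] DomE μ a b →L[ℝ] ℝ :=
  (innerSL ℝ : L2 a b ℝ →L[ℝ] L2 a b ℝ →L[ℝ] ℝ).bilinearComp
    ((weakDerivL a b).comp (DomE μ a b).subtypeL) ((weakDerivL a b).comp (DomE μ a b).subtypeL)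

section Form

variable {μ : Measure ℝ} [IsFiniteMeasure μ] {a b : ℝ}

lemma energyL_eq_inner (u v : DomE μ a b) :
    energyL μ a b u v = inner ℝ (weakDeriv u.1) (weakDeriv v.1) := rfl

lemma energyL_symm (u v : DomE μ a b) : energyL μ a b u v = energyL μ a b v u := by
  rw [energyL_eq_inner, energyL_eq_inner, real_inner_comm]

lemma energyL_apply (u v : DomE μ a b) : energyL μ a b u v = energy u.1 v.1 := by
  rw [energyL_symm, energy_eq_inner, energyL_eq_inner]

/-- `V` carries the full `H¹` norm, so coercivity is the Poincaré inequality. -/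
lemma isCoercive_energyL : IsCoercive (energyL μ a b) := by
  obtain ⟨C, hC, h⟩ := exists_poincare a b
  refine ⟨C⁻¹, inv_pos.2 hC, fun u => ?_⟩
  have h1 := h u.1
  have h2 : energyL μ a b u u = ‖weakDeriv u.1‖ ^ 2 := by
    rw [energyL_eq_inner, real_inner_self_eq_norm_sq]
  rw [h2, mul_assoc, ← sq, inv_mul_le_iff₀ hC]
  exact h1

/-- The embedding `L²_μ ↪ (Dom E)'` as a bounded linear map. -/
def toDualEL (μ : Measure ℝ) [IsFiniteMeasure μ] (a b : ℝ) : L2mu μ →L[ℝ] DualE μ a b :=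
  (ContinuousLinearMap.precomp ℝ (toL2mu μ a b)).comp (innerSL ℝ)

end Form

/-! ### Operations on primitives. -/

section Primitive

variable {X : Type*} [NormedAddCommGroup X] [NormedSpace ℝ X] {T : ℝ}

lemma IsPrimitive.congr {w w' z z' : ℝ → X} {x₀ : X} (h : IsPrimitive T w w' x₀)
    (hz : w =ᵐ[volume.restrict (Ioo 0 T)] z) (hz' : w' =ᵐ[volume.restrict (Ioo 0 T)] z') :
    IsPrimitive T z z' x₀ := by
  refine ⟨h.integrable_deriv.congr hz', ?_⟩
  filter_upwards [h.ae_eq, hz, ae_restrict_mem measurableSet_Ioo] with t h1 h2 ht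
  rw [← h2, h1, integral_primitive_congr hz' t (Ioo_subset_Icc_self ht)]

lemma IsPrimitive.sub {w w' z z' : ℝ → X} {x₀ y₀ : X} (h : IsPrimitive T w w' x₀)
    (hz : IsPrimitive T z z' y₀) :
    IsPrimitive T (fun t => w t - z t) (fun t => w' t - z' t) (x₀ - y₀) := by
  refine ⟨h.integrable_deriv.sub hz.integrable_deriv, ?_⟩
  filter_upwards [h.ae_eq, hz.ae_eq, ae_restrict_mem measurableSet_Ioo] with t h1 h2 ht
  have htI := Ioo_subset_Icc_self ht
  have h0 : (0 : ℝ) ∈ Icc 0 T := ⟨le_rfl, htI.1.trans htI.2⟩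
  rw [h1, h2, intervalIntegral.integral_sub
    (intervalIntegrable_of_integrable_restrict h.integrable_deriv h0 htI)
    (intervalIntegrable_of_integrable_restrict hz.integrable_deriv h0 htI)]
  abel

lemma IsPrimitive.clm_comp [CompleteSpace X] {Y : Type*} [NormedAddCommGroup Y]
    [NormedSpace ℝ Y] [CompleteSpace Y] (L : X →L[ℝ] Y) {w w' : ℝ → X} {x₀ : X}
    (h : IsPrimitive T w w' x₀) : IsPrimitive T (fun t => L (w t)) (fun t => L (w' t)) (L x₀) := by
  refine ⟨L.integrable_comp h.integrable_deriv, ?_⟩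
  filter_upwards [h.ae_eq, ae_restrict_mem measurableSet_Ioo] with t h1 ht
  have htI := Ioo_subset_Icc_self ht
  have h0 : (0 : ℝ) ∈ Icc 0 T := ⟨le_rfl, htI.1.trans htI.2⟩
  rw [h1, map_add, L.intervalIntegral_comp_comm
    (intervalIntegrable_of_integrable_restrict h.integrable_deriv h0 htI)]

end Primitive

lemma exists_L2_ae_eq_clm {X Y : Type*} [NormedAddCommGroup X] [NormedSpace ℝ X]
    [NormedAddCommGroup Y] [NormedSpace ℝ Y] {T : ℝ} (L : X →L[ℝ] Y) (u : L2 0 T X) :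
    ∃ w : L2 0 T Y, ∀ᵐ t ∂volume.restrict (Ioo 0 T), w t = L (u t) :=
  ⟨L.compLp u, L.coeFn_compLp u⟩

/-! ### Weak solutions of the wave equation. -/

section Solutions

variable {μ : Measure ℝ} [IsFiniteMeasure μ] {a b T : ℝ}

/-- The source enters the abstract equation through its image in `L²_μ`. The second derivative is
read off from the equation as `(f, ·)_μ - E(u, ·)`, which lies in `L²(0,T; (Dom E)')` because both
terms are bounded linear images of `L²` functions. -/
lemma exists_isWeakSolution (hT : 0 < T) (g : DomE μ a b) (h : L2mu μ) (f : L2 0 T (DomE μ a b)) :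
    ∃ u, IsWeakSolution μ a b T g h f u := by
  obtain ⟨u, v, hu, hv⟩ := exists_isPrimitive (j := toL2mu μ a b) isCoercive_energyL energyL_symm
    hT g h ((toL2mu μ a b).compLp f)
  obtain ⟨w₁, hw₁⟩ := exists_L2_ae_eq_clm (Y := DualE μ a b) (toDualEL μ a b)
    ((toL2mu μ a b).compLp f)
  obtain ⟨w₂, hw₂⟩ := exists_L2_ae_eq_clm (Y := DualE μ a b) (energyL μ a b) u
  have hae : ∀ᵐ t ∂volume.restrict (Ioo 0 T), (w₁ - w₂ : L2 0 T (DualE μ a b)) t =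
      toDualEL μ a b ((toL2mu μ a b).compLp f t) - energyL μ a b (u t) := by
    filter_upwards [Lp.coeFn_sub w₁ w₂, hw₁, hw₂] with t h1 h2 h3
    rw [h1, Pi.sub_apply, h2, h3]
  have hv' : IsPrimitive T (fun t => toDualE μ a b (v t)) (w₁ - w₂ : L2 0 T (DualE μ a b))
      (toDualE μ a b h) :=
    hv.congr (Filter.EventuallyEq.refl _ _) (hae.mono fun t ht => ht.symm)
  refine ⟨u, v, w₁ - w₂, hu.hasWeakDeriv, hv'.hasWeakDeriv, fun x => ?_, hu.hasInitialValue,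
    hv'.hasInitialValue⟩
  filter_upwards [hae, (toL2mu μ a b).coeFn_compLp f] with t h1 h2
  rw [h1, h2, ← energyL_apply]
  exact sub_add_cancel _ _

lemma IsWeakSolution.unique (hT : 0 < T) {g : DomE μ a b} {h : L2mu μ}
    {f u₁ u₂ : L2 0 T (DomE μ a b)} (h₁ : IsWeakSolution μ a b T g h f u₁)
    (h₂ : IsWeakSolution μ a b T g h f u₂) : u₁ = u₂ := by
  obtain ⟨v₁, w₁, hv₁, hw₁, he₁, hg₁, hh₁⟩ := h₁
  obtain ⟨v₂, w₂, hv₂, hw₂, he₂, hg₂, hh₂⟩ := h₂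
  have hu := (hv₁.isPrimitive hT hg₁).sub (hv₂.isPrimitive hT hg₂)
  have hv := (hw₁.isPrimitive hT hh₁).sub (hw₂.isPrimitive hT hh₂)
  rw [sub_self] at hu hv
  have key := ae_eq_zero_of_isPrimitive (j := toL2mu μ a b) (isCoercive_energyL) energyL_symm
    (u := fun t => u₁ t - u₂ t) (v := fun t => v₁ t - v₂ t)
    ((integrable_of_L2 u₁).sub (integrable_of_L2 u₂))
    (hu.congr (Filter.Eventually.of_forall fun t => (map_sub (toL2mu μ a b) _ _).symm)
      (Filter.EventuallyEq.refl _ _)) fun x => by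
      -- The weak equation holds off a null set that depends on `x`. The uniqueness theorem asks for
      -- a scalar identity for each `x` separately, so these null sets need not be combined.
      have hx := hv.clm_comp (ContinuousLinearMap.apply ℝ ℝ x)
      rw [map_zero] at hx
      refine hx.congr (Filter.Eventually.of_forall fun t => ?_) ?_
      · exact (inner_sub_left (v₁ t) (v₂ t) (toL2mu μ a b x)).symm
      · filter_upwards [he₁ x, he₂ x] with t h1 h2
        rw [← energyL_apply] at h1 h2
        have e : ContinuousLinearMap.apply ℝ ℝ x (w₁ t - w₂ t) = w₁ t x - w₂ t x := rfl
        rw [e, map_sub, sub_apply]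
        linarith
  refine Lp.ext ?_
  filter_upwards [key] with t ht
  exact sub_eq_zero.1 ht

end Solutions

end FractalWave

end

open FractalWave in
theorem theorem1p1 (μ : MeasureTheory.Measure ℝ) [MeasureTheory.IsFiniteMeasure μ]
    (a b T : ℝ) (hab : a < b) (hT : 0 < T)
    (hsupp : μ.support ⊆ Set.Icc a b) (hpos : 0 < μ (Set.Ioo a b))
    (hμa : μ {a} = 0) (hμb : μ {b} = 0)
    (g : DomE μ a b) (h : L2mu μ) (f : L2 0 T (DomE μ a b)) :
    ∃! u : L2 0 T (DomE μ a b), IsWeakSolution μ a b T g h f u := by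
  obtain ⟨u, hu⟩ := exists_isWeakSolution hT g h f
  exact ⟨u, hu, fun u' hu' => hu'.unique hT hu⟩
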